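/- **Setting.** Let $G=(V,E)$ be a finite bipartite graph with colour classes $F$ and $W$, with capacities $b(e)>0$ ($e\in E$), quotas $q(v)>0$ ($v\in V$), and, for each $v\in V$, a weak linear order (a transitive and total relation) $\ge_v$ on the set $E_v$ of edges incident to $v$; its equivalence classes are called ties, and they are linearly ordered by preference. For a nonnegative function $z$ on $E_v$ with $z\le b$ put $|z|=\sum_e z(e)$. If $|z|\ge q(v)$, the *critical tie* of $z$ is the tie $\pi$ such that the total of $z$ over the ties better than $\pi$ is $<q(v)$ and the total over $\pi$ and the better ties is $\ge q(v)$, and the *cutting height* $r^z$ is the (least) $r$ for which the total of $z$ over the ties better than $\pi$ plus $\sum_{e\in\pi}\min\{r,z(e)\}$ equals $q(v)$. The choice function $C_v$ is defined by $C_v(z)=z$ if $|z|\le q(v)$; and if $|z|>q(v)$, then $C_v(z)(e)$ is $z(e)$ for $e$ in the ties better than the critical one, $\min\{r^z,z(e)\}$ for $e$ in the critical tie, and $0$ for $e$ in the worse ties. For $z,z'$ with $C_v(z)=z$, $C_v(z')=z'$ write $z\succeq_v z'$ if $C_v(z\vee z')=z$, where $z\vee z'$ is the pointwise maximum. An edge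 $e\in E_v$ is *interesting* for $v$ under $z$ if there is $z'$ with $0\le z'\le b$ on $E_v$, $z'(e)>z(e)$, $z'=z$ on $E_v\setminus\{e\}$ and $C_v(z')(e)>z(e)$. A function $x:E\to\mathbb R$ with $0\le x\le b$ is a *stable assignment* if $C_v(x_v)=x_v$ for all $v\in V$, where $x_v$ is the restriction of $x$ to $E_v$, and no edge is interesting for both of its ends (under the restrictions of $x$). Let $\mathcal S$ be the set of stable assignments. For $x,y\in\mathcal S$ write $x\succeq y$ if $x_f\succeq_f y_f$ for all $f\in F$, $x\succ y$ if moreover $x\ne y$, and $x\succeq_W y$ if $x_w\succeq_w y_w$ for all $w\in W$. Let $x^{\max}$ be the greatest element of $(\mathcal S,\succeq_W)$ (the worst stable assignment for $F$). **Heads.** Let $x\in\mathcal S$. A vertex $v$ is *fully filled* if $|x_v|=q(v)$, and *deficit* otherwise. For fully filled $v$, the *head* $H_v$ is the set of edges $e$ in the critical tie of $x_v$ with $x(e)=r^{x_v}$, and the *tail* $T_v$ consists of the other edges of the critical tie and the edges of the better ties. For deficit $v$ put $H_v=\emptyset$, $T_v=E_v$. An edge is *unsaturated* if $x(e)<b(e)$.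 For a fully filled $f\in F$, consider the ties $\pi$ at $f$ such that (i) the set of unsaturated edges $e=fw\in\pi$ with $e\in T_w$ is nonempty, and (ii) no tie at $f$ better than or equal to $\pi$ contains an unsaturated edge incident to a deficit vertex of $W$. If such ties exist, then $D_f$ denotes the set in (i) for the best of them; otherwise $D_f=\emptyset$. A set of *singular* vertices is grown as follows. Initially it consists of the fully filled $w\in W$ such that $H_w$ contains an edge incident to a deficit vertex, and the fully filled $f\in F$ with $D_f=\emptyset$. Then, as long as possible, one adds a fully filled vertex $f\in F$ (resp. $w\in W$) such that $D_f$ (resp. $H_w$) contains an edge incident to a vertex already in the set. Let $F^+\subseteq F$ and $W^+\subseteq W$ be the sets of fully filled vertices that are not singular. **Balance system.** For $\varepsilon>0$ let $\mathcal P^\varepsilon(x)$ be the set of $(\phi,\psi)\in\mathbb R^{F^+}\times\mathbb R^{W^+}$ such that $$|D_f|\,\phi_f-\sum(\psi_w:\ w\in W^+,\ fw\in H_w)=0\quad (f\in F^+),$$ $$|H_w|\,\psi_w-\sum(\phi_f:\ f\in F^+,\ fw\in D_f)=0\quad (w\in W^+),$$ $$\sum_{f\in F^+}|D_f|\,\phi_f+\sum_{w\in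 W^+}|H_w|\,\psi_w=\varepsilon,\qquad \phi\ge0,\ \psi\ge0.$$ For such $(\phi,\psi)$ define $\Delta^{\phi,\psi}\in\mathbb R^E$ on $e=fw$ by: $\phi_f$ if $f\in F^+$ and $e\in D_f$; $-\psi_w$ if $w\in W^+$ and $e\in H_w$; and $0$ otherwise. Finally, let $$X^\varepsilon(x)=\{x'\in\mathcal S:\ x'\prec x,\ \textstyle\sum_{e\in E}|x'(e)-x(e)|=\varepsilon\}.$$ **Theorem.** Let $x\in\mathcal S$, $x\ne x^{\max}$. (a) For all sufficiently small $\varepsilon>0$, the set $\mathcal P^\varepsilon(x)$ is a polytope (that is, it is bounded) and $X^\varepsilon(x)=\{x+\Delta^{\phi,\psi}:\ (\phi,\psi)\in\mathcal P^\varepsilon(x)\}$. (b) If $y\in\mathcal S$ and $y\prec x$, then for all sufficiently small $\varepsilon>0$ (how small may depend on $y$) there is $x'\in X^\varepsilon(x)$ with $y\preceq x'\prec x$. -/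

import Mathlib

noncomputable section

/-! ## One agent: weak order, quota, choice function of mixed type

`ι` is the set of edges at the agent, `ge e e'` means that `e` is at least as good as `e'`,
`q` is the quota, and `z : ι → ℝ` is a nonnegative assignment on these edges.
A tie is a class of the equivalence `ge e e' ∧ ge e' e`. -/

namespace MixedChoice

open scoped Classical

variable {ι : Type*} [Fintype ι]

/-- `e` is strictly preferred to `e'`. -/
def Better (ge : ι → ι → Prop) (e e' : ι) : Prop := ge e e' ∧ ¬ ge e' e

/-- The critical tie: the tie for which the total of `z` over the strictly better ties is `< q`,
whereas the total over this tie and all better ones is `≥ q`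
(it exists and is unique if `0 < q ≤ |z|`). -/
def criticalTie (ge : ι → ι → Prop) (q : ℝ) (z : ι → ℝ) : Finset ι :=
  Finset.univ.filter fun e =>
    (∑ e' with Better ge e' e, z e') < q ∧ q ≤ ∑ e' with ge e' e, z e'

/-- The edges in the ties better than the critical one. -/
def before (ge : ι → ι → Prop) (q : ℝ) (z : ι → ℝ) : Finset ι :=
  Finset.univ.filter fun e => ∃ c ∈ criticalTie ge q z, Better ge e c

/-- The cutting height `r` in the critical tie: the solution of
`z(before) + ∑_{e ∈ criticalTie} min(r, z e) = q`. The solution is unique if the right inequality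
defining the critical tie is strict; otherwise (in particular if `|z| = q`) every sufficiently
large `r` is a solution, and the smallest one, the maximum of `z` on the critical tie, is taken. -/
def cutHeight (ge : ι → ι → Prop) (q : ℝ) (z : ι → ℝ) : ℝ :=
  sInf {r : ℝ | ∑ e ∈ before ge q z, z e + ∑ e ∈ criticalTie ge q z, min r (z e) = q}

/-- The choice function of mixed type. -/
def choice (ge : ι → ι → Prop) (q : ℝ) (z : ι → ℝ) : ι → ℝ := fun e =>
  if ∑ e', z e' ≤ q then z e
  else if e ∈ before ge q z then z e
  else if e ∈ criticalTie ge q z then min (cutHeight ge q z) (z e)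
  else 0

/-- The box `0 ≤ z ≤ b`. -/
def box (b : ι → ℝ) : Set (ι → ℝ) := {z | ∀ e, 0 ≤ z e ∧ z e ≤ b e}

/-- Stationary assignments: the members of the box fixed by the choice function. -/
def stationary (ge : ι → ι → Prop) (q : ℝ) (b : ι → ℝ) : Set (ι → ℝ) :=
  {z | z ∈ box b ∧ choice ge q z = z}

/-- Revealed preference: `z` is at least as good as `z'` if `C(z ∨ z') = z`. -/
def Prefers (ge : ι → ι → Prop) (q : ℝ) (z z' : ι → ℝ) : Prop :=
  choice ge q (fun e => max (z e) (z' e)) = z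

/-- The head of a stationary `z`: if `z` is quota filling, the edges of the critical tie at which
`z` equals the cutting height; empty if `z` is deficit. -/
def head (ge : ι → ι → Prop) (q : ℝ) (z : ι → ℝ) : Finset ι :=
  if ∑ e, z e = q then (criticalTie ge q z).filter fun e => z e = cutHeight ge q z else ∅

/-- The tail of a stationary `z`: if `z` is quota filling, the edges in the critical tie and the
better ties that are not in the head; all edges if `z` is deficit. -/
def tail (ge : ι → ι → Prop) (q : ℝ) (z : ι → ℝ) : Finset ι :=
  if ∑ e, z e = q then before ge q z ∪ (criticalTie ge q z \ head ge q z) else Finset.univ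

/-- The edge `e` is interesting under `z`: some admissible `z'` obtained from `z` by increasing the
value at `e` only satisfies `C(z')(e) > z(e)`. -/
def Interesting (ge : ι → ι → Prop) (q : ℝ) (b : ι → ℝ) (z : ι → ℝ) (e : ι) : Prop :=
  ∃ z' ∈ box b, z e < z' e ∧ (∀ e', e' ≠ e → z' e' = z e') ∧ z e < choice ge q z' e

end MixedChoice

/-! ## The stable assignment problem of mixed type on a bipartite graph -/

/-- A vertex `v` (a firm or a worker) is an end of the edge `e = fw`. -/
def Incident {F W : Type*} (v : F ⊕ W) (e : F × W) : Prop :=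
  match v with
  | Sum.inl f => e.1 = f
  | Sum.inr w => e.2 = w

/-- An instance: a bipartite graph with color classes `F`, `W` and edge set `E`, positive capacities
`b` and quotas `q`, and for each vertex `v` a weak linear order (transitive and total relation)
on the set of edges incident to `v`. -/
structure MixedProblem (F W : Type*) where
  E : Finset (F × W)
  b : {e // e ∈ E} → ℝ
  b_pos : ∀ e, 0 < b e
  q : F ⊕ W → ℝ
  q_pos : ∀ v, 0 < q v
  ge : (v : F ⊕ W) → {e : {e // e ∈ E} // Incident v e.1} →
    {e : {e // e ∈ E} // Incident v e.1} → Prop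
  ge_trans : ∀ v e e' e'', ge v e e' → ge v e' e'' → ge v e e''
  ge_total : ∀ v e e', ge v e e' ∨ ge v e' e

namespace MixedProblem

open scoped Classical

variable {F W : Type*} (P : MixedProblem F W)

/-- Edges of the graph. -/
abbrev Edge : Type _ := {e : F × W // e ∈ P.E}

/-- The set `E_v` of edges incident to `v`. -/
abbrev Star (v : F ⊕ W) : Type _ := {e : P.Edge // Incident v e.1}

/-- The end of `e` in `F`. -/
abbrev firm (e : P.Edge) : F := e.1.1

/-- The end of `e` in `W`. -/
abbrev worker (e : P.Edge) : W := e.1.2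

/-- The edge `e`, seen as a member of `E_f` for its end `f ∈ F`. -/
def atFirm (e : P.Edge) : P.Star (Sum.inl (P.firm e)) := ⟨e, rfl⟩

/-- The edge `e`, seen as a member of `E_w` for its end `w ∈ W`. -/
def atWorker (e : P.Edge) : P.Star (Sum.inr (P.worker e)) := ⟨e, rfl⟩

/-- The restriction `x_v` of `x` to `E_v`. -/
def restr {α : Type*} (x : P.Edge → α) (v : F ⊕ W) : P.Star v → α := fun e => x e.1

/-- `e` is blocking for `x`: it is interesting for both of its ends. -/
def Blocking (x : P.Edge → ℝ) (e : P.Edge) : Prop :=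
  MixedChoice.Interesting (P.ge (Sum.inl (P.firm e))) (P.q (Sum.inl (P.firm e)))
      (P.restr P.b (Sum.inl (P.firm e))) (P.restr x (Sum.inl (P.firm e))) (P.atFirm e) ∧
    MixedChoice.Interesting (P.ge (Sum.inr (P.worker e))) (P.q (Sum.inr (P.worker e)))
      (P.restr P.b (Sum.inr (P.worker e))) (P.restr x (Sum.inr (P.worker e))) (P.atWorker e)

/-- The set of stable assignments: admissible, stationary at each vertex, without blocking edges. -/
def stable : Set (P.Edge → ℝ) :=
  {x | (∀ e, 0 ≤ x e ∧ x e ≤ P.b e) ∧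
    (∀ v, P.restr x v ∈ MixedChoice.stationary (P.ge v) (P.q v) (P.restr P.b v)) ∧
    ∀ e, ¬ P.Blocking x e}

/-- `x ⪰_F y`. -/
def PrefersF (x y : P.Edge → ℝ) : Prop :=
  ∀ f : F, MixedChoice.Prefers (P.ge (Sum.inl f)) (P.q (Sum.inl f))
    (P.restr x (Sum.inl f)) (P.restr y (Sum.inl f))

/-- `x ⪰_W y`. -/
def PrefersW (x y : P.Edge → ℝ) : Prop :=
  ∀ w : W, MixedChoice.Prefers (P.ge (Sum.inr w)) (P.q (Sum.inr w))
    (P.restr x (Sum.inr w)) (P.restr y (Sum.inr w))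

/-- `x ≻_F y`. -/
def StrictlyPrefersF (x y : P.Edge → ℝ) : Prop := P.PrefersF x y ∧ x ≠ y

/-- `x` is the assignment `x^max`, the greatest element of the set of stable assignments with
respect to `⪰_W`. -/
def IsXmax (x : P.Edge → ℝ) : Prop := x ∈ P.stable ∧ ∀ y ∈ P.stable, P.PrefersW x y

/-- `X^ε(x)`: the stable `x' ≺_F x` with `|x' - x| = ε`. -/
def close (x : P.Edge → ℝ) (ε : ℝ) : Set (P.Edge → ℝ) :=
  {x' | x' ∈ P.stable ∧ P.StrictlyPrefersF x x' ∧ ∑ e, |x' e - x e| = ε}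

/-- `v` is fully filled by `x` (otherwise it is deficit). -/
def FullyFilled (x : P.Edge → ℝ) (v : F ⊕ W) : Prop := ∑ e, P.restr x v e = P.q v

/-- The edge `e` is unsaturated by `x`. -/
def Unsaturated (x : P.Edge → ℝ) (e : P.Edge) : Prop := x e < P.b e

/-- The head `H_v(x)`, as a set of edges of the graph. -/
def head (x : P.Edge → ℝ) (v : F ⊕ W) : Finset P.Edge :=
  (MixedChoice.head (P.ge v) (P.q v) (P.restr x v)).image Subtype.val

/-- The tail `T_v(x)`, as a set of edges of the graph. -/
def tail (x : P.Edge → ℝ) (v : F ⊕ W) : Finset P.Edge :=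
  (MixedChoice.tail (P.ge v) (P.q v) (P.restr x v)).image Subtype.val

/-- `e ∈ E_f` belongs to one of the sets `D^i_f(x)` whose tie `π^i` belongs to `Π̂_f(x)`:
(a) `e = fw` is unsaturated and lies in `T_w(x)`, and (b) no tie better than or equal to the tie
of `e` contains an unsaturated edge incident to a deficit vertex of `W`. -/
def Candidate (x : P.Edge → ℝ) (f : F) (e : P.Star (Sum.inl f)) : Prop :=
  (P.Unsaturated x e.1 ∧ e.1 ∈ P.tail x (Sum.inr (P.worker e.1))) ∧
    ∀ e' : P.Star (Sum.inl f), P.ge (Sum.inl f) e' e → P.Unsaturated x e'.1 →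
      P.FullyFilled x (Sum.inr (P.worker e'.1))

/-- The potential head `D_f(x)` of a fully filled `f`: the set `D^i_f(x)` for the best tie `π^i` in
`Π̂_f(x)`, empty if `Π̂_f(x)` is empty. -/
def potentialHead (x : P.Edge → ℝ) (f : F) : Finset P.Edge :=
  (Finset.univ.filter fun e : P.Star (Sum.inl f) => P.FullyFilled x (Sum.inl f) ∧
    P.Candidate x f e ∧ ∀ e', P.Candidate x f e' → P.ge (Sum.inl f) e e').image Subtype.val

/-- `D_f(x)` for `v = f ∈ F` and `H_w(x)` for `v = w ∈ W`. -/
def outHead (x : P.Edge → ℝ) : F ⊕ W → Finset P.Edge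
  | Sum.inl f => P.potentialHead x f
  | Sum.inr w => P.head x (Sum.inr w)

/-- The singular vertices, i.e. the result of the cleaning procedure: start with the fully filled
`w ∈ W` having an edge of `H_w(x)` incident to a deficit vertex and the fully filled `f ∈ F` with
`D_f(x) = ∅`; repeatedly add each fully filled vertex whose head (`D_f(x)` or `H_w(x)`) has an edge
incident to a vertex added before. -/
inductive Singular (x : P.Edge → ℝ) : F ⊕ W → Prop
  | ofWorker (w : W) (e : P.Edge) (hw : P.FullyFilled x (Sum.inr w))
      (he : e ∈ P.head x (Sum.inr w)) (hd : ¬ P.FullyFilled x (Sum.inl (P.firm e))) :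
      Singular x (Sum.inr w)
  | ofFirm (f : F) (hf : P.FullyFilled x (Sum.inl f)) (hD : P.potentialHead x f = ∅) :
      Singular x (Sum.inl f)
  | step (v u : F ⊕ W) (e : P.Edge) (hv : P.FullyFilled x v) (he : e ∈ P.outHead x v)
      (hu : Incident u e.1) (hs : Singular x u) : Singular x v

/-- Regular vertices: fully filled and not singular. -/
def Regular (x : P.Edge → ℝ) (v : F ⊕ W) : Prop := P.FullyFilled x v ∧ ¬ P.Singular x v

/-- The set `F⁺` of regular firms. -/
abbrev FPlus (x : P.Edge → ℝ) : Type _ := {f : F // P.Regular x (Sum.inl f)}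

/-- The set `W⁺` of regular workers. -/
abbrev WPlus (x : P.Edge → ℝ) : Type _ := {w : W // P.Regular x (Sum.inr w)}

/-- The pair `fw` is an edge of the graph lying in the set `S`. -/
def EdgeIn (S : Finset P.Edge) (f : F) (w : W) : Prop := ∃ h : (f, w) ∈ P.E, ⟨(f, w), h⟩ ∈ S

/-- The set `𝒫^ε(x)` of solutions `(φ, ψ)` of the balance system: for each `f ∈ F⁺` the increase on
`D_f` equals the decrease on the other edges at `f`, for each `w ∈ W⁺` the decrease on `H_w` equals
the increase on the other edges at `w`, the total change is `ε`, and `φ, ψ ≥ 0`. -/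
def balancePolytope [Fintype F] [Fintype W] (x : P.Edge → ℝ) (ε : ℝ) :
    Set ((P.FPlus x → ℝ) × (P.WPlus x → ℝ)) :=
  {p | (∀ f : P.FPlus x, ((P.potentialHead x f.1).card : ℝ) * p.1 f -
          ∑ w : P.WPlus x with P.EdgeIn (P.head x (Sum.inr w.1)) f.1 w.1, p.2 w = 0) ∧
    (∀ w : P.WPlus x, ((P.head x (Sum.inr w.1)).card : ℝ) * p.2 w -
          ∑ f : P.FPlus x with P.EdgeIn (P.potentialHead x f.1) f.1 w.1, p.1 f = 0) ∧
    (∑ f : P.FPlus x, ((P.potentialHead x f.1).card : ℝ) * p.1 f +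
          ∑ w : P.WPlus x, ((P.head x (Sum.inr w.1)).card : ℝ) * p.2 w = ε) ∧
    (∀ f, 0 ≤ p.1 f) ∧ (∀ w, 0 ≤ p.2 w)}

/-- The vector `Δ^{φ,ψ}` on the edges: `φ_f` on `D_f` for `f ∈ F⁺`, `-ψ_w` on `H_w` for `w ∈ W⁺`,
and `0` elsewhere (`D_f` and `H_w` are disjoint). -/
def Delta (x : P.Edge → ℝ) (p : (P.FPlus x → ℝ) × (P.WPlus x → ℝ)) : P.Edge → ℝ := fun e =>
  if h : P.Regular x (Sum.inl (P.firm e)) ∧ e ∈ P.potentialHead x (P.firm e) then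
    p.1 ⟨P.firm e, h.1⟩
  else if h : P.Regular x (Sum.inr (P.worker e)) ∧ e ∈ P.head x (Sum.inr (P.worker e)) then
    - p.2 ⟨P.worker e, h.1⟩
  else 0

end MixedProblem

end

/-! Everything is rewritten in terms of tails. For one agent, `z` is preferred to `z'` iff `z' ≤ z`
on the tail of `z` (`prefers_iff`), and an edge is interesting iff it is unsaturated and in the tail
(`interesting_iff`). So stability says that no unsaturated edge lies in the tails of both its ends
(`mem_stable_iff`). Polarity follows: if `y` is worse than `x` for `F`, it is better for `W`.
Counting edges from both sides, every vertex has the same total under `x` and `y`, and deficit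
vertices do not change at all (`sum_restr_eq`, `eq_of_not_fullyFilled`).

For (a), let `η` be half the smallest gap among values and residual capacities of `x`. If `y` is
stable, worse for `F` and within `η` of `x`, then at a worker only head edges decrease, all by the
same amount, and the tail is unchanged (`worker_side`). Edges that are unsaturated and in their
worker's tail ("raisable") keep this property under `y`, so they lie outside the firm's tail under
`y`. Edges outside a tail are at most as good as the support and equal within a tie, so the
increases at `f` take place on `D_f`, uniformly. Immobility spreads backwards along heads, so
singular vertices stay put, and `y - x` is a balance vector (`exists_eq_add_Delta`). Conversely, a
small balanced shift keeps the workers' tails, while a firm that raises `D_f` gets a tail of edges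
at least as good as `D_f` but not in `D_f`. A blocking edge there would be a raisable edge that
belongs to `D_f` after all (`add_Delta_mem_stable`).

For (b), with `y` possibly far away, call a vertex moved if `x` and `y` differ there. Head edges of
moved vertices lead to moved vertices, so moved vertices are regular, and the random walk along head
edges has a stationary vector. It yields a balance vector supported on moved vertices
(`exists_mem_balancePolytope`), and a short step along it stays above `y`. -/

noncomputable section

namespace MixedChoice

open scoped Classical

variable {ι : Type*} {ge : ι → ι → Prop} {q : ℝ} {z z' : ι → ℝ} {c e : ι}

/-- A transitive and total relation. -/
structure IsWeakOrder (ge : ι → ι → Prop) : Prop where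
  trans : ∀ {a b c}, ge a b → ge b c → ge a c
  total : ∀ a b, ge a b ∨ ge b a

theorem IsWeakOrder.refl (h : IsWeakOrder ge) (a : ι) : ge a a := (h.total a a).elim id id

theorem IsWeakOrder.of_not (h : IsWeakOrder ge) {a b : ι} (hab : ¬ ge a b) : ge b a :=
  (h.total a b).resolve_left hab

theorem IsWeakOrder.swap (h : IsWeakOrder ge) : IsWeakOrder fun a b => ge b a :=
  ⟨fun hab hbc => h.trans hbc hab, fun a b => h.total b a⟩

theorem IsWeakOrder.exists_worst (h : IsWeakOrder ge) {s : Finset ι} (hs : s.Nonempty) :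
    ∃ c ∈ s, ∀ e ∈ s, ge e c := by
  induction hs using Finset.Nonempty.cons_induction with
  | singleton a => exact ⟨a, by simp, by simpa using h.refl a⟩
  | cons a s ha hs ih =>
    obtain ⟨c, hc, hmin⟩ := ih
    rcases h.total a c with hac | hca
    · refine ⟨c, by simp [hc], fun e he => ?_⟩
      rcases Finset.mem_cons.1 he with rfl | he
      exacts [hac, hmin e he]
    · refine ⟨a, by simp, fun e he => ?_⟩
      rcases Finset.mem_cons.1 he with rfl | he
      exacts [h.refl _, h.trans (hmin e he) hca]

theorem IsWeakOrder.exists_best (h : IsWeakOrder ge) {s : Finset ι} (hs : s.Nonempty) :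
    ∃ c ∈ s, ∀ e ∈ s, ge c e :=
  h.swap.exists_worst hs

theorem sum_min_lt_sum_min {s : Finset ι} (hc : c ∈ s) {r r' : ℝ} (hr : r < r')
    (hr' : r' ≤ z c) : ∑ e ∈ s, min r (z e) < ∑ e ∈ s, min r' (z e) := by
  refine Finset.sum_lt_sum (fun e _ => min_le_min_right _ hr.le) ⟨c, hc, ?_⟩
  rw [min_eq_left hr', min_eq_left (hr.le.trans hr')]
  exact hr

variable [Fintype ι]

theorem sum_filter_ge (ge : ι → ι → Prop) (z : ι → ℝ) (c : ι) :
    ∑ e with ge e c, z e = ∑ e with Better ge e c, z e + ∑ e with ge e c ∧ ge c e, z e := by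
  have := Finset.sum_filter_add_sum_filter_not (Finset.univ.filter fun e => ge e c)
    (fun e => ge c e) z
  rw [Finset.filter_filter, Finset.filter_filter] at this
  rw [← this, add_comm]
  congr! 2
  ext e
  simp only [Finset.mem_filter, Finset.mem_univ, true_and]
  rfl

/-! ### The critical tie and the cutting height -/

/-- Two critical edges share a tie: if `b` were strictly better than `a`, the mass at least `q`
reached at `b` would already lie strictly above `a`. -/
theorem mem_criticalTie_iff_of_mem (h : IsWeakOrder ge) (hz : ∀ e, 0 ≤ z e)
    (hc : c ∈ criticalTie ge q z) : e ∈ criticalTie ge q z ↔ ge e c ∧ ge c e := by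
  have key : ∀ {a b}, a ∈ criticalTie ge q z → b ∈ criticalTie ge q z → ge a b := by
    intro a b ha hb
    by_contra hab
    simp only [criticalTie, Finset.mem_filter, Finset.mem_univ, true_and] at ha hb
    have : ∑ e with ge e b, z e ≤ ∑ e with Better ge e a, z e := by
      refine Finset.sum_le_sum_of_subset_of_nonneg (fun e he => ?_) fun e _ _ => hz e
      simp only [Finset.mem_filter, Finset.mem_univ, true_and] at he ⊢
      exact ⟨h.trans he (h.of_not hab), fun hae => hab (h.trans hae he)⟩
    linarith [ha.1, hb.2]
  refine ⟨fun he => ⟨key he hc, key hc he⟩, fun ⟨h1, h2⟩ => ?_⟩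
  simp only [criticalTie, Finset.mem_filter, Finset.mem_univ, true_and] at hc ⊢
  have e1 : (Finset.univ.filter fun a => Better ge a e) =
      Finset.univ.filter fun a => Better ge a c := by
    ext a
    simp only [Finset.mem_filter, Finset.mem_univ, true_and]
    exact ⟨fun ⟨p, r⟩ => ⟨h.trans p h1, fun s => r (h.trans h1 s)⟩,
      fun ⟨p, r⟩ => ⟨h.trans p h2, fun s => r (h.trans h2 s)⟩⟩
  have e2 : (Finset.univ.filter fun a => ge a e) = Finset.univ.filter fun a => ge a c := by
    ext a
    simp only [Finset.mem_filter, Finset.mem_univ, true_and]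
    exact ⟨fun p => h.trans p h1, fun p => h.trans p h2⟩
  rwa [e1, e2]

theorem criticalTie_eq_of_mem (h : IsWeakOrder ge) (hz : ∀ e, 0 ≤ z e)
    (hc : c ∈ criticalTie ge q z) :
    criticalTie ge q z = Finset.univ.filter fun e => ge e c ∧ ge c e := by
  ext e
  simp [mem_criticalTie_iff_of_mem h hz hc]

theorem before_eq_of_mem (h : IsWeakOrder ge) (hz : ∀ e, 0 ≤ z e)
    (hc : c ∈ criticalTie ge q z) :
    before ge q z = Finset.univ.filter fun e => Better ge e c := by
  ext e
  simp only [before, Finset.mem_filter, Finset.mem_univ, true_and]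
  refine ⟨fun ⟨d, hd, he⟩ => ?_, fun he => ⟨c, hc, he⟩⟩
  obtain ⟨h1, h2⟩ := (mem_criticalTie_iff_of_mem h hz hc).1 hd
  exact ⟨h.trans he.1 h1, fun s => he.2 (h.trans h1 s)⟩

theorem exists_mem_criticalTie (h : IsWeakOrder ge) (hq : 0 < q) (hz : ∀ e, 0 ≤ z e)
    (hs : q ≤ ∑ e, z e) : ∃ c, c ∈ criticalTie ge q z := by
  have hne : (Finset.univ : Finset ι).Nonempty := by
    by_contra hne
    rw [Finset.not_nonempty_iff_eq_empty.1 hne, Finset.sum_empty] at hs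
    linarith
  obtain ⟨m, -, hm⟩ := h.exists_worst hne
  have hS : (Finset.univ.filter fun c => q ≤ ∑ e with ge e c, z e).Nonempty := by
    refine ⟨m, ?_⟩
    simpa [Finset.filter_true_of_mem fun e he => hm e he] using hs
  obtain ⟨c, hc, hbest⟩ := h.exists_best hS
  simp only [Finset.mem_filter, Finset.mem_univ, true_and] at hc hbest
  refine ⟨c, ?_⟩
  simp only [criticalTie, Finset.mem_filter, Finset.mem_univ, true_and]
  refine ⟨lt_of_not_ge fun hq' => ?_, hc⟩
  have hB : (Finset.univ.filter fun e => Better ge e c).Nonempty := by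
    by_contra hne
    rw [Finset.not_nonempty_iff_eq_empty.1 hne, Finset.sum_empty] at hq'
    linarith
  obtain ⟨d, hd, hworst⟩ := h.exists_worst hB
  simp only [Finset.mem_filter, Finset.mem_univ, true_and] at hd hworst
  refine hd.2 (hbest d (hq'.trans ?_))
  refine Finset.sum_le_sum_of_subset_of_nonneg (fun e he => ?_) fun e _ _ => hz e
  simp only [Finset.mem_filter, Finset.mem_univ, true_and] at he ⊢
  exact hworst e he

theorem sum_before_lt (h : IsWeakOrder ge) (hz : ∀ e, 0 ≤ z e) (hc : c ∈ criticalTie ge q z) :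
    ∑ e ∈ before ge q z, z e < q := by
  rw [before_eq_of_mem h hz hc]
  exact (Finset.mem_filter.1 hc).2.1

theorem le_sum_before_add (h : IsWeakOrder ge) (hz : ∀ e, 0 ≤ z e)
    (hc : c ∈ criticalTie ge q z) :
    q ≤ ∑ e ∈ before ge q z, z e + ∑ e ∈ criticalTie ge q z, z e := by
  rw [before_eq_of_mem h hz hc, criticalTie_eq_of_mem h hz hc, ← sum_filter_ge]
  exact (Finset.mem_filter.1 hc).2.2

/-- The truncated sum is strictly increasing in the height up to `z c`, so a solution not exceeding
`z c` is the least one. -/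
theorem cutHeight_eq (hc : c ∈ criticalTie ge q z) {r : ℝ} (hr : r ≤ z c)
    (hsum : ∑ e ∈ before ge q z, z e + ∑ e ∈ criticalTie ge q z, min r (z e) = q) :
    cutHeight ge q z = r := by
  refine IsLeast.csInf_eq ⟨hsum, fun s hs => le_of_not_gt fun hlt => ?_⟩
  have := sum_min_lt_sum_min hc hlt hr
  rw [Set.mem_ofPred_eq] at hs
  linarith

theorem sum_cutHeight (h : IsWeakOrder ge) (hz : ∀ e, 0 ≤ z e) (hc : c ∈ criticalTie ge q z) :
    ∑ e ∈ before ge q z, z e +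
      ∑ e ∈ criticalTie ge q z, min (cutHeight ge q z) (z e) = q := by
  set g : ℝ → ℝ := fun r =>
    ∑ e ∈ before ge q z, z e + ∑ e ∈ criticalTie ge q z, min r (z e) with hg
  have hcont : Continuous g := by fun_prop
  have hclosed : IsClosed {r | g r = q} := isClosed_eq hcont continuous_const
  have h0 : g 0 ≤ q := by
    have : ∑ e ∈ criticalTie ge q z, min 0 (z e) = 0 :=
      Finset.sum_eq_zero fun e _ => min_eq_left (hz e)
    simpa [hg, this] using (sum_before_lt h hz hc).le
  have h1 : q ≤ g (∑ e, z e) := by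
    have : ∑ e ∈ criticalTie ge q z, min (∑ e, z e) (z e) = ∑ e ∈ criticalTie ge q z, z e :=
      Finset.sum_congr rfl fun e _ =>
        min_eq_right (Finset.single_le_sum (fun i _ => hz i) (Finset.mem_univ e))
    simpa only [hg, this] using le_sum_before_add h hz hc
  obtain ⟨r, -, hr⟩ := intermediate_value_Icc (Finset.sum_nonneg fun e _ => hz e)
    hcont.continuousOn ⟨h0, h1⟩
  -- The infimum is attained because the solution set is closed, nonempty and bounded below by 0: a
  -- negative height gives a sum below `q`.
  refine hclosed.csInf_mem ⟨r, hr⟩ ⟨0, fun s hs => le_of_not_gt fun hlt => ?_⟩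
  have := sum_min_lt_sum_min hc hlt (hz c)
  rw [Set.mem_ofPred_eq] at hs
  have h2 := sum_before_lt h hz hc
  have h3 : ∑ e ∈ criticalTie ge q z, min s (z e) ≤ ∑ e ∈ criticalTie ge q z, min 0 (z e) :=
    this.le
  have h4 : ∑ e ∈ criticalTie ge q z, min 0 (z e) = 0 :=
    Finset.sum_eq_zero fun e _ => min_eq_left (hz e)
  simp only [hg] at hs
  linarith

/-! ### Elementary properties of the choice function -/

theorem choice_of_sum_le (hs : ∑ e, z e ≤ q) : choice ge q z = z := by
  funext e
  simp [choice, hs]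

theorem choice_of_lt_sum (h : IsWeakOrder ge) (hz : ∀ e, 0 ≤ z e) (hs : q < ∑ e, z e)
    (hc : c ∈ criticalTie ge q z) :
    choice ge q z e = if Better ge e c then z e
      else if ge e c ∧ ge c e then min (cutHeight ge q z) (z e) else 0 := by
  simp [choice, not_le.2 hs, before_eq_of_mem h hz hc, mem_criticalTie_iff_of_mem h hz hc]

theorem choice_le (hz : ∀ e, 0 ≤ z e) (e : ι) : choice ge q z e ≤ z e := by
  unfold choice
  split_ifs
  exacts [le_rfl, le_rfl, min_le_right _ _, hz e]

theorem sum_choice (h : IsWeakOrder ge) (hq : 0 < q) (hz : ∀ e, 0 ≤ z e) (hs : q < ∑ e, z e) :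
    ∑ e, choice ge q z e = q := by
  obtain ⟨c, hc⟩ := exists_mem_criticalTie h hq hz hs.le
  refine Eq.trans ?_ (sum_cutHeight h hz hc)
  rw [before_eq_of_mem h hz hc, criticalTie_eq_of_mem h hz hc,
    Finset.sum_filter, Finset.sum_filter, ← Finset.sum_add_distrib]
  refine Finset.sum_congr rfl fun e _ => ?_
  rw [choice_of_lt_sum h hz hs hc]
  by_cases h1 : Better ge e c
  · have h2 : ¬ (ge e c ∧ ge c e) := fun h2 => h1.2 h2.2
    simp [h1, h2]
  · simp [h1]

theorem mem_stationary_iff (h : IsWeakOrder ge) (hq : 0 < q) {b : ι → ℝ} :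
    z ∈ stationary ge q b ↔ z ∈ box b ∧ ∑ e, z e ≤ q := by
  refine ⟨fun ⟨hb, hz⟩ => ⟨hb, le_of_not_gt fun hs => ?_⟩, fun ⟨hb, hs⟩ =>
    ⟨hb, choice_of_sum_le hs⟩⟩
  have := sum_choice h hq (fun e => (hb e).1) hs
  rw [hz] at this
  linarith

/-! ### Heads and tails -/

/-- `c` lies in the worst tie meeting the support of `z`, and `z` attains at `c` its positive
maximum over this tie. -/
structure IsCut (ge : ι → ι → Prop) (z : ι → ℝ) (c : ι) : Prop where
  pos : 0 < z c
  le : ∀ e, ge c e → z e ≤ z c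
  eq_zero : ∀ e, ¬ ge e c → z e = 0

theorem exists_isCut (h : IsWeakOrder ge) (hz : ∀ e, 0 ≤ z e) (hs : 0 < ∑ e, z e) :
    ∃ c, IsCut ge z c := by
  have hS : (Finset.univ.filter fun e => 0 < z e).Nonempty := by
    obtain ⟨e, -, he⟩ := Finset.exists_lt_of_sum_lt (s := Finset.univ) (f := fun _ => (0 : ℝ))
      (g := z) (by simpa using hs)
    exact ⟨e, by simpa using he⟩
  obtain ⟨d, hd, hworst⟩ := h.exists_worst hS
  simp only [Finset.mem_filter, Finset.mem_univ, true_and] at hd hworst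
  obtain ⟨c, hc, hmax⟩ := Finset.exists_max_image (Finset.univ.filter fun e => ge e d ∧ ge d e) z
    ⟨d, by simp [h.refl]⟩
  simp only [Finset.mem_filter, Finset.mem_univ, true_and] at hc hmax
  have hpos : 0 < z c := hd.trans_le (hmax d ⟨h.refl d, h.refl d⟩)
  have hzero : ∀ e, ¬ ge e c → z e = 0 := fun e he =>
    le_antisymm (not_lt.1 fun hlt => he (h.trans (hworst e hlt) hc.2)) (hz e)
  refine ⟨c, hpos, fun e he => ?_, hzero⟩
  by_cases hec : ge e c
  · exact hmax e ⟨h.trans hec hc.1, h.trans hc.2 he⟩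
  · rw [hzero e hec]
    exact hpos.le

/-- The edges at least as good as `c` carry the whole mass `q`, and `0 < z c` makes the strictly
better ones fall short of it. Thus a cut edge describes head and tail without sums. -/
theorem IsCut.mem_criticalTie (h : IsWeakOrder ge) (hz : ∀ e, 0 ≤ z e) (hs : ∑ e, z e = q)
    (hc : IsCut ge z c) : c ∈ criticalTie ge q z := by
  have h1 : ∑ e with ge e c, z e = q := by
    rw [← hs, Finset.sum_filter]
    exact Finset.sum_congr rfl fun e _ => by
      split_ifs with hec
      exacts [rfl, (hc.eq_zero e hec).symm]
  have h2 := sum_filter_ge ge z c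
  have h3 : z c ≤ ∑ e with ge e c ∧ ge c e, z e :=
    Finset.single_le_sum (f := z) (fun e _ => hz e) (by simp [h.refl])
  simp only [criticalTie, Finset.mem_filter, Finset.mem_univ, true_and]
  exact ⟨by linarith [hc.pos], h1.ge⟩

theorem IsCut.cutHeight_eq (h : IsWeakOrder ge) (hz : ∀ e, 0 ≤ z e) (hs : ∑ e, z e = q)
    (hc : IsCut ge z c) : cutHeight ge q z = z c := by
  have hm := hc.mem_criticalTie h hz hs
  refine MixedChoice.cutHeight_eq hm le_rfl (le_antisymm ?_ ?_)
  · rw [before_eq_of_mem h hz hm, criticalTie_eq_of_mem h hz hm, ← hs]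
    calc _ ≤ ∑ e with Better ge e c, z e + ∑ e with ge e c ∧ ge c e, z e := by
          gcongr
          exact min_le_right _ _
      _ = ∑ e with ge e c, z e := (sum_filter_ge ge z c).symm
      _ ≤ _ := Finset.sum_le_sum_of_subset_of_nonneg (Finset.filter_subset _ _) fun e _ _ => hz e
  · refine (le_sum_before_add h hz hm).trans_eq ?_
    congr 1
    refine Finset.sum_congr rfl fun e he => (min_eq_right (hc.le e ?_)).symm
    exact ((mem_criticalTie_iff_of_mem h hz hm).1 he).2

theorem IsCut.mem_head_iff (h : IsWeakOrder ge) (hz : ∀ e, 0 ≤ z e) (hs : ∑ e, z e = q)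
    (hc : IsCut ge z c) : e ∈ head ge q z ↔ ge c e ∧ z e = z c := by
  have hm := hc.mem_criticalTie h hz hs
  rw [head, if_pos hs, Finset.mem_filter, mem_criticalTie_iff_of_mem h hz hm,
    hc.cutHeight_eq h hz hs]
  refine ⟨fun ⟨h1, h2⟩ => ⟨h1.2, h2⟩, fun ⟨h1, h2⟩ => ⟨⟨?_, h1⟩, h2⟩⟩
  by_contra hec
  linarith [hc.eq_zero e hec, hc.pos]

theorem IsCut.mem_tail_iff (h : IsWeakOrder ge) (hz : ∀ e, 0 ≤ z e) (hs : ∑ e, z e = q)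
    (hc : IsCut ge z c) : e ∈ tail ge q z ↔ ge e c ∧ (ge c e → z e < z c) := by
  have hm := hc.mem_criticalTie h hz hs
  rw [tail, if_pos hs, Finset.mem_union, Finset.mem_sdiff, hc.mem_head_iff h hz hs,
    mem_criticalTie_iff_of_mem h hz hm, before_eq_of_mem h hz hm, Finset.mem_filter]
  simp only [Better, Finset.mem_univ, true_and]
  constructor
  · rintro (⟨h1, h2⟩ | ⟨⟨h1, h2⟩, h3⟩)
    · exact ⟨h1, fun h3 => absurd h3 h2⟩
    · exact ⟨h1, fun _ => lt_of_le_of_ne (hc.le e h2) fun h4 => h3 ⟨h2, h4⟩⟩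
  · rintro ⟨h1, h2⟩
    by_cases h3 : ge c e
    · exact Or.inr ⟨⟨h1, h3⟩, fun h4 => (h2 h3).ne h4.2⟩
    · exact Or.inl ⟨h1, h3⟩

theorem IsCut.notMem_tail_iff (h : IsWeakOrder ge) (hz : ∀ e, 0 ≤ z e) (hs : ∑ e, z e = q)
    (hc : IsCut ge z c) : e ∉ tail ge q z ↔ ge c e ∧ (ge e c → z c ≤ z e) := by
  rw [hc.mem_tail_iff h hz hs]
  constructor
  · intro h1
    by_cases h2 : ge e c
    · have h3 : ge c e ∧ z c ≤ z e := by
        by_contra h3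
        exact h1 ⟨h2, fun h4 => not_le.1 fun h5 => h3 ⟨h4, h5⟩⟩
      exact ⟨h3.1, fun _ => h3.2⟩
    · exact ⟨h.of_not h2, fun h3 => absurd h3 h2⟩
  · rintro ⟨h1, h2⟩ ⟨h3, h4⟩
    exact (h4 h1).not_ge (h2 h3)

theorem tail_of_ne (hs : ∑ e, z e ≠ q) : tail ge q z = Finset.univ := if_neg hs

theorem head_of_ne (hs : ∑ e, z e ≠ q) : head ge q z = ∅ := if_neg hs

theorem sum_eq_of_notMem_tail (he : e ∉ tail ge q z) : ∑ e, z e = q := by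
  by_contra hs
  simp [tail_of_ne hs] at he

theorem sum_eq_of_mem_head (he : e ∈ head ge q z) : ∑ e, z e = q := by
  by_contra hs
  simp [head_of_ne hs] at he

theorem eq_cutHeight_of_mem_head (he : e ∈ head ge q z) : z e = cutHeight ge q z := by
  rw [head, if_pos (sum_eq_of_mem_head he)] at he
  exact (Finset.mem_filter.1 he).2

theorem head_nonempty (h : IsWeakOrder ge) (hq : 0 < q) (hz : ∀ e, 0 ≤ z e)
    (hs : ∑ e, z e = q) : (head ge q z).Nonempty := by
  obtain ⟨c, hc⟩ := exists_isCut h hz (hs ▸ hq)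
  exact ⟨c, (hc.mem_head_iff h hz hs).2 ⟨h.refl c, rfl⟩⟩

theorem pos_of_mem_head (h : IsWeakOrder ge) (hq : 0 < q) (hz : ∀ e, 0 ≤ z e)
    (he : e ∈ head ge q z) : 0 < z e := by
  have hs := sum_eq_of_mem_head he
  obtain ⟨c, hc⟩ := exists_isCut h hz (hs ▸ hq)
  rw [((hc.mem_head_iff h hz hs).1 he).2]
  exact hc.pos

theorem notMem_tail_of_mem_head (h : IsWeakOrder ge) (hq : 0 < q) (hz : ∀ e, 0 ≤ z e)
    (he : e ∈ head ge q z) : e ∉ tail ge q z := by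
  have hs := sum_eq_of_mem_head he
  obtain ⟨c, hc⟩ := exists_isCut h hz (hs ▸ hq)
  obtain ⟨h1, h2⟩ := (hc.mem_head_iff h hz hs).1 he
  exact (hc.notMem_tail_iff h hz hs).2 ⟨h1, fun _ => h2.ge⟩

end MixedChoice
end

/-! ### One agent: preference, interest and small changes through tails -/

noncomputable section

namespace MixedChoice

open scoped Classical

variable {ι : Type*} [Fintype ι] {ge : ι → ι → Prop} {q : ℝ} {z z' b : ι → ℝ} {c d e : ι}

/-! ### Preferences and interesting edges in terms of tails -/

/-- Truncating `m = z ∨ z'` yields `z`, and no tail edge is truncated: it lies before the critical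
tie of `m`, or in it with a value below `z c`, which is at most the cutting height. -/
theorem Prefers.le_of_mem_tail (h : IsWeakOrder ge) (hq : 0 < q) (hz : ∀ e, 0 ≤ z e)
    (hp : Prefers ge q z z') (he : e ∈ tail ge q z) : z' e ≤ z e := by
  set m : ι → ℝ := fun e => max (z e) (z' e) with hm
  have hzm : ∀ e, z e ≤ m e := fun e => le_max_left _ _
  have hm0 : ∀ e, 0 ≤ m e := fun e => (hz e).trans (hzm e)
  have hp' : choice ge q m = z := hp
  have hgoal : m e = z e → z' e ≤ z e := fun h1 => (le_max_right (z e) (z' e)).trans_eq h1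
  by_cases hms : ∑ e, m e ≤ q
  · rw [choice_of_sum_le hms] at hp'
    exact hgoal (congrFun hp' e)
  · have hms' := not_le.1 hms
    have hsq : ∑ e, z e = q := by
      rw [← sum_choice h hq hm0 hms', hp']
    obtain ⟨c, hc⟩ := exists_isCut h hz (hsq ▸ hq)
    obtain ⟨k, hk⟩ := exists_mem_criticalTie h hq hm0 hms'.le
    have hval : ∀ e, z e = if Better ge e k then m e
        else if ge e k ∧ ge k e then min (cutHeight ge q m) (m e) else 0 := fun e => by
      rw [← choice_of_lt_sum h hm0 hms' hk, hp']
    obtain ⟨hec, hlt⟩ := (hc.mem_tail_iff h hz hsq).1 he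
    have hck : ge c k := by
      by_contra hck
      have h1 := hval c
      rw [if_neg fun h2 => hck h2.1, if_neg fun h2 => hck h2.1] at h1
      exact hc.pos.ne' h1
    by_cases h1 : Better ge e k
    · exact hgoal (by rw [hval e, if_pos h1])
    · have hek := h.trans hec hck
      have hke : ge k e := by
        by_contra hke
        exact h1 ⟨hek, hke⟩
      have hve := hval e
      have hvc := hval c
      rw [if_neg h1, if_pos ⟨hek, hke⟩] at hve
      rw [if_neg fun h2 => h2.2 (h.trans hke hec), if_pos ⟨hck, h.trans hke hec⟩] at hvc
      have hlt' := hlt (h.trans hck hke)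
      have h3 : z c ≤ cutHeight ge q m := hvc.trans_le (min_le_left _ _)
      rcases min_choice (cutHeight ge q m) (m e) with h4 | h4
      · rw [h4] at hve
        linarith
      · rw [h4] at hve
        exact hgoal hve.symm

/-- On the tail the maximum `m` equals `z`. If `z` fills the quota and `m` exceeds it, a cut edge
`c` of `z` is critical for `m` with height `z c`, and truncating `m` there returns `z`. -/
theorem prefers_of_forall_mem_tail (h : IsWeakOrder ge) (hq : 0 < q) (hz : ∀ e, 0 ≤ z e)
    (hs : ∑ e, z e ≤ q) (ht : ∀ e ∈ tail ge q z, z' e ≤ z e) : Prefers ge q z z' := by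
  set m : ι → ℝ := fun e => max (z e) (z' e) with hm
  have hzm : ∀ e, z e ≤ m e := fun e => le_max_left _ _
  have hm0 : ∀ e, 0 ≤ m e := fun e => (hz e).trans (hzm e)
  have htm : ∀ e ∈ tail ge q z, m e = z e := fun e he => max_eq_left (ht e he)
  change choice ge q m = z
  by_cases hsq : ∑ e, z e = q
  · by_cases hms : ∑ e, m e ≤ q
    · rw [choice_of_sum_le hms]
      have h1 := (Finset.sum_eq_sum_iff_of_le fun e _ => hzm e).1
        (le_antisymm (Finset.sum_le_sum fun e _ => hzm e) (hms.trans hsq.ge))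
      funext e
      exact (h1 e (Finset.mem_univ e)).symm
    · have hms' := not_le.1 hms
      obtain ⟨c, hc⟩ := exists_isCut h hz (hsq ▸ hq)
      have hcz := hc.mem_criticalTie h hz hsq
      have hbetter : ∀ e, Better ge e c → m e = z e := fun e he =>
        htm e ((hc.mem_tail_iff h hz hsq).2 ⟨he.1, fun h1 => absurd h1 he.2⟩)
      have hmin : ∀ e, ge c e → ge e c → min (z c) (m e) = z e := fun e h1 h2 => by
        by_cases h3 : z e < z c
        · rw [htm e ((hc.mem_tail_iff h hz hsq).2 ⟨h2, fun _ => h3⟩), min_eq_right h3.le]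
        · have h4 : z e = z c := le_antisymm (hc.le e h1) (not_lt.1 h3)
          rw [← h4, min_eq_left (hzm e)]
      have hsum : ∑ e with Better ge e c, m e = ∑ e with Better ge e c, z e :=
        Finset.sum_congr rfl fun e he => hbetter e (Finset.mem_filter.1 he).2
      have hcm : c ∈ criticalTie ge q m := by
        simp only [criticalTie, Finset.mem_filter, Finset.mem_univ, true_and] at hcz ⊢
        exact ⟨hsum.trans_lt hcz.1, hcz.2.trans (Finset.sum_le_sum fun e _ => hzm e)⟩
      have hheight : cutHeight ge q m = z c := by
        refine cutHeight_eq hcm (hzm c) ?_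
        have h1 := sum_cutHeight h hz hcz
        rw [hc.cutHeight_eq h hz hsq, before_eq_of_mem h hz hcz,
          criticalTie_eq_of_mem h hz hcz] at h1
        rw [before_eq_of_mem h hm0 hcm, criticalTie_eq_of_mem h hm0 hcm, hsum]
        refine Eq.trans ?_ h1
        congr 1
        refine Finset.sum_congr rfl fun e he => ?_
        obtain ⟨h2, h3⟩ := (Finset.mem_filter.1 he).2
        rw [hmin e h3 h2, min_eq_right (hc.le e h3)]
      funext e
      rw [choice_of_lt_sum h hm0 hms' hcm, hheight]
      split_ifs with h1 h2
      · exact hbetter e h1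
      · exact hmin e h2.2 h2.1
      · refine (hc.eq_zero e fun h3 => ?_).symm
        by_cases h4 : ge c e
        exacts [h2 ⟨h3, h4⟩, h1 ⟨h3, h4⟩]
  · have hmz : m = z := funext fun e => htm e (by simp [tail_of_ne hsq])
    rw [hmz, choice_of_sum_le hs]

theorem prefers_iff (h : IsWeakOrder ge) (hq : 0 < q) (hz : ∀ e, 0 ≤ z e)
    (hs : ∑ e, z e ≤ q) : Prefers ge q z z' ↔ ∀ e ∈ tail ge q z, z' e ≤ z e :=
  ⟨fun hp _ he => hp.le_of_mem_tail h hq hz he, prefers_of_forall_mem_tail h hq hz hs⟩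

theorem interesting_iff (h : IsWeakOrder ge) (hq : 0 < q) (hz : z ∈ box b)
    (hs : ∑ e, z e ≤ q) : Interesting ge q b z e ↔ z e < b e ∧ e ∈ tail ge q z := by
  have hz0 : ∀ e, 0 ≤ z e := fun e => (hz e).1
  constructor
  · rintro ⟨z', hb', hlt, hother, hch⟩
    refine ⟨hlt.trans_le (hb' e).2, ?_⟩
    by_contra he
    have hp : Prefers ge q z z' := by
      refine prefers_of_forall_mem_tail h hq hz0 hs fun e' he' => (hother e' ?_).le
      rintro rfl
      exact he he'
    have hmax : (fun e => max (z e) (z' e)) = z' := by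
      funext a
      by_cases ha : a = e
      · rw [ha, max_eq_right hlt.le]
      · rw [hother a ha, max_self]
    rw [Prefers, hmax] at hp
    rw [hp] at hch
    exact hch.false
  · rintro ⟨hlt, he⟩
    -- Raising `e` to its full capacity suffices as a witness. If the extra amount were rejected,
    -- `z` would be preferred to `z'`, contradicting `le_of_mem_tail`.
    set z' := Function.update z e (b e) with hz'
    have hze : z' e = b e := by simp [hz']
    have hother : ∀ a, a ≠ e → z' a = z a := fun a ha => by simp [hz', ha]
    have hle : ∀ a, z a ≤ z' a := fun a => by
      by_cases ha : a = e
      · rw [ha, hze]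
        exact hlt.le
      · rw [hother a ha]
    have hz'0 : ∀ a, 0 ≤ z' a := fun a => (hz0 a).trans (hle a)
    refine ⟨z', fun a => ⟨hz'0 a, ?_⟩, by rwa [hze], hother, ?_⟩
    · by_cases ha : a = e
      · rw [ha, hze]
      · rw [hother a ha]
        exact (hz a).2
    · by_contra hch
      have hchz : ∀ a, choice ge q z' a ≤ z a := fun a => by
        by_cases ha : a = e
        · rw [ha]
          exact not_lt.1 hch
        · rw [← hother a ha]
          exact choice_le hz'0 a
      by_cases hs' : ∑ a, z' a ≤ q
      · rw [choice_of_sum_le hs', hze] at hch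
        exact hch hlt
      -- The choice totals `q`, which `z` does not exceed, so being pointwise at most `z` it equals
      -- `z`.
      · have h1 := sum_choice h hq hz'0 (not_le.1 hs')
        have h2 := (Finset.sum_eq_sum_iff_of_le fun a _ => hchz a).1
          (le_antisymm (Finset.sum_le_sum fun a _ => hchz a) (hs.trans h1.ge))
        have hmax : (fun a => max (z a) (z' a)) = z' := funext fun a => max_eq_right (hle a)
        have hp : Prefers ge q z z' := by
          rw [Prefers, hmax]
          exact funext fun a => h2 a (Finset.mem_univ a)
        have h3 := hp.le_of_mem_tail h hq hz0 he
        rw [hze] at h3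
        exact h3.not_gt hlt

/-! ### Pairs of assignments -/

/-- Two edges outside the tail and in the same tie have equal values. -/
theorem eq_of_notMem_tail (h : IsWeakOrder ge) (hq : 0 < q) (hz : ∀ e, 0 ≤ z e)
    (hd : d ∉ tail ge q z) (he : e ∉ tail ge q z) (hde : ge d e) (hed : ge e d) :
    z d = z e := by
  have hs := sum_eq_of_notMem_tail hd
  obtain ⟨c, hc⟩ := exists_isCut h hz (hs ▸ hq)
  obtain ⟨d1, d2⟩ := (hc.notMem_tail_iff h hz hs).1 hd
  obtain ⟨e1, e2⟩ := (hc.notMem_tail_iff h hz hs).1 he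
  by_cases hdc : ge d c
  · exact le_antisymm ((hc.le d d1).trans (e2 (h.trans hed hdc)))
      ((hc.le e e1).trans (d2 hdc))
  · rw [hc.eq_zero d hdc, hc.eq_zero e fun h1 => hdc (h.trans hde h1)]

/-- An edge outside the tail is at most as good as every edge of the support. -/
theorem ge_of_notMem_tail (h : IsWeakOrder ge) (hq : 0 < q) (hz : ∀ e, 0 ≤ z e)
    (hd : d ∉ tail ge q z) (he : 0 < z e) : ge e d := by
  have hs := sum_eq_of_notMem_tail hd
  obtain ⟨c, hc⟩ := exists_isCut h hz (hs ▸ hq)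
  obtain ⟨d1, -⟩ := (hc.notMem_tail_iff h hz hs).1 hd
  refine h.trans ?_ d1
  by_contra h1
  exact he.ne' (hc.eq_zero e h1)

/-- Outside the tail the value is maximal among the edges that are at most as good. -/
theorem le_of_notMem_tail (h : IsWeakOrder ge) (hq : 0 < q) (hz : ∀ e, 0 ≤ z e)
    (hd : d ∉ tail ge q z) (hde : ge d e) : z e ≤ z d := by
  have hs := sum_eq_of_notMem_tail hd
  obtain ⟨c, hc⟩ := exists_isCut h hz (hs ▸ hq)
  obtain ⟨d1, d2⟩ := (hc.notMem_tail_iff h hz hs).1 hd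
  by_cases hdc : ge d c
  · exact (hc.le e (h.trans d1 hde)).trans (d2 hdc)
  · rw [hc.eq_zero e]
    · exact hz d
    · intro hec
      exact hdc (h.trans hde hec)

theorem exists_lt_of_lt (hs : ∑ e, z' e ≤ ∑ e, z e) (he : z e < z' e) : ∃ d, z' d < z d := by
  by_contra! hcon
  exact hs.not_gt (Finset.sum_lt_sum (fun d _ => hcon d) ⟨e, Finset.mem_univ e, he⟩)

/-- If `z` is preferred to `z'`, then the edges where `z` is larger lie in the tail of `z'`. -/
theorem mem_tail_of_lt (h : IsWeakOrder ge) (hq : 0 < q) (hz : ∀ e, 0 ≤ z e)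
    (hz' : ∀ e, 0 ≤ z' e) (hs : ∑ e, z e ≤ q) (ht : ∀ e ∈ tail ge q z, z' e ≤ z e)
    (he : z' e < z e) : e ∈ tail ge q z' := by
  by_contra hn
  have hs' := sum_eq_of_notMem_tail hn
  obtain ⟨d, hd⟩ := exists_lt_of_lt (hs.trans hs'.ge) he
  have hdt : d ∉ tail ge q z := fun h1 => (ht d h1).not_gt hd
  have hed : ge e d := ge_of_notMem_tail h hq hz hdt ((hz' e).trans_lt he)
  have hde : ge d e := ge_of_notMem_tail h hq hz' hn ((hz d).trans_lt hd)
  -- Now `d` and `e` share a tie, which gives the contradiction `z e ≤ z d < z' d ≤ z' e < z e`.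
  have h1 := le_of_notMem_tail h hq hz hdt hde
  have h2 := le_of_notMem_tail h hq hz' hn hed
  linarith

/-- If `z` is preferred to `z' ≠ z` and both fill the quota, then `z` is smaller than `z'` on the
head of `z'`. -/
theorem lt_of_mem_head (h : IsWeakOrder ge) (hq : 0 < q) (hz : ∀ e, 0 ≤ z e)
    (hz' : ∀ e, 0 ≤ z' e) (hs : ∑ e, z e = ∑ e, z' e)
    (ht : ∀ e ∈ tail ge q z, z' e ≤ z e) (hne : z ≠ z') (he : e ∈ head ge q z') :
    z e < z' e := by
  have hs' := sum_eq_of_mem_head he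
  obtain ⟨d, hd⟩ : ∃ d, z d < z' d := by
    by_contra! hcon
    refine hne (funext fun a => ?_)
    exact ((Finset.sum_eq_sum_iff_of_le fun a _ => hcon a).1 hs.symm a (Finset.mem_univ a)).symm
  have hdt : d ∉ tail ge q z := fun h1 => (ht d h1).not_gt hd
  have het := notMem_tail_of_mem_head h hq hz' he
  have hde : ge d e := ge_of_notMem_tail h hq hz' het ((hz d).trans_lt hd)
  have h1 := le_of_notMem_tail h hq hz hdt hde
  by_cases hed : ge e d
  · have h2 := le_of_notMem_tail h hq hz' het hed
    linarith
  · have h2 : ¬ 0 < z e := fun h3 => hed (ge_of_notMem_tail h hq hz hdt h3)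
    exact (not_lt.1 h2).trans_lt (pos_of_mem_head h hq hz' he)

/-- If `z` is preferred to `z'` and `z'` is larger at `e`, then no edge at least as good as `e`
with equal values lies outside both tails. -/
theorem not_ge_of_lt (h : IsWeakOrder ge) (hq : 0 < q) (hz : ∀ e, 0 ≤ z e)
    (hz' : ∀ e, 0 ≤ z' e) (ht : ∀ e ∈ tail ge q z, z' e ≤ z e) (he : z e < z' e)
    (hd : d ∉ tail ge q z) (hd' : d ∉ tail ge q z') (hdd : z' d ≤ z d) : ¬ ge d e := by
  intro hde
  have hed : ge e d := ge_of_notMem_tail h hq hz' hd' ((hz e).trans_lt he)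
  -- The cycle is `z' e ≤ z' d ≤ z d = z e < z' e`.
  have h1 := le_of_notMem_tail h hq hz' hd' hde
  have h2 := eq_of_notMem_tail h hq hz hd (fun h3 => (ht e h3).not_gt he) hde hed
  linarith

/-! ### Small changes -/

/-- A uniform decrease on the head together with a small change on the tail keeps head and tail. -/
theorem head_tail_eq_of_close (h : IsWeakOrder ge) (hq : 0 < q) (hz : ∀ e, 0 ≤ z e)
    (hz' : ∀ e, 0 ≤ z' e) (hs : ∑ e, z e = q) (hs' : ∑ e, z' e = q) {η : ℝ}
    (hclose : ∀ e, |z' e - z e| < η) (hpos : ∀ e, 0 < z e → 2 * η ≤ z e)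
    (hgap : ∀ d e, z d < z e → 2 * η ≤ z e - z d)
    (hhead : ∀ d ∈ head ge q z, ∀ e ∈ head ge q z, z' d = z' e)
    (hzero : ∀ e, e ∉ tail ge q z → z e = 0 → z' e = 0) :
    head ge q z' = head ge q z ∧ tail ge q z' = tail ge q z := by
  obtain ⟨c, hc⟩ := exists_isCut h hz (hs ▸ hq)
  have hlow : ∀ e, z e - η < z' e := fun e => by linarith [(abs_lt.1 (hclose e)).1]
  have hupp : ∀ e, z' e < z e + η := fun e => by linarith [(abs_lt.1 (hclose e)).2]
  have hη : 0 < η := (abs_nonneg _).trans_lt (hclose c)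
  have hch : c ∈ head ge q z := (hc.mem_head_iff h hz hs).2 ⟨h.refl c, rfl⟩
  have heq : ∀ e, ge c e → z e = z c → z' e = z' c := fun e h1 h2 =>
    hhead e ((hc.mem_head_iff h hz hs).2 ⟨h1, h2⟩) c hch
  have hlt : ∀ e, z e < z c → z' e < z' c := fun e h1 => by
    linarith [hgap e c h1, hlow c, hupp e]
  -- The same edge remains a cut: the gap `2 * η` preserves positivity and strict inequalities, and
  -- uniformity on the head preserves the equalities.
  have hc' : IsCut ge z' c := by
    refine ⟨by linarith [hlow c, hpos c hc.pos], fun e he => ?_, fun e he => ?_⟩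
    · rcases (hc.le e he).lt_or_eq with h1 | h1
      exacts [(hlt e h1).le, (heq e he h1).le]
    · exact hzero e (fun h1 => he ((hc.mem_tail_iff h hz hs).1 h1).1) (hc.eq_zero e he)
  have hiff : ∀ e, ge c e → (z' e < z' c ↔ z e < z c) := fun e he =>
    ⟨fun h1 => lt_of_le_of_ne (hc.le e he) fun h2 => h1.ne (heq e he h2), hlt e⟩
  constructor
  · ext e
    rw [hc'.mem_head_iff h hz' hs', hc.mem_head_iff h hz hs]
    refine and_congr_right fun he => ?_
    have h1 := not_congr (hiff e he)
    rw [not_lt, not_lt] at h1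
    exact ⟨fun h2 => le_antisymm (hc.le e he) (h1.1 h2.ge), heq e he⟩
  · ext e
    rw [hc'.mem_tail_iff h hz' hs', hc.mem_tail_iff h hz hs]
    exact and_congr_right fun _ => forall_congr' fun he => hiff e he

/-- A preferred assignment close to `z` has the same tail as `z`, is at most `z` only on the head
of `z`, and decreases it uniformly. -/
theorem tail_eq_of_close (h : IsWeakOrder ge) (hq : 0 < q) (hz : ∀ e, 0 ≤ z e)
    (hz' : ∀ e, 0 ≤ z' e) (hs : ∑ e, z e = q) (hs' : ∑ e, z' e = q) {η : ℝ}
    (hclose : ∀ e, |z' e - z e| < η) (hpos : ∀ e, 0 < z e → 2 * η ≤ z e)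
    (hgap : ∀ d e, z d < z e → 2 * η ≤ z e - z d)
    (ht : ∀ e ∈ tail ge q z', z e ≤ z' e) :
    tail ge q z' = tail ge q z ∧ (∀ e, z' e < z e → e ∈ head ge q z) ∧
      ∀ d ∈ head ge q z, ∀ e ∈ head ge q z, z' d = z' e := by
  by_cases hne : z' = z
  · subst hne
    refine ⟨rfl, fun e he => absurd he (lt_irrefl _), fun d hd e he => ?_⟩
    obtain ⟨c, hc⟩ := exists_isCut h hz (hs ▸ hq)
    rw [((hc.mem_head_iff h hz hs).1 hd).2, ((hc.mem_head_iff h hz hs).1 he).2]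
  obtain ⟨c, hc⟩ := exists_isCut h hz (hs ▸ hq)
  have hlow : ∀ e, z e - η < z' e := fun e => by linarith [(abs_lt.1 (hclose e)).1]
  have hupp : ∀ e, z' e < z e + η := fun e => by linarith [(abs_lt.1 (hclose e)).2]
  have hη : 0 < η := (abs_nonneg _).trans_lt (hclose c)
  have hposz : ∀ e, 0 < z e → 0 < z' e := fun e he => by linarith [hlow e, hpos e he]
  -- A decreasing edge is outside the tail of `z'`, hence maximal under `z'` among edges at most as
  -- good. A value `z e < z c` would leave it below `c` after the small change.
  have hdec : ∀ e, z' e < z e → e ∈ head ge q z := fun e he => by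
    have he' : e ∉ tail ge q z' := fun h1 => (ht e h1).not_gt he
    have hce : ge c e := ge_of_notMem_tail h hq hz' he' (hposz c hc.pos)
    refine (hc.mem_head_iff h hz hs).2 ⟨hce, le_antisymm (hc.le e hce) (not_lt.1 fun h1 => ?_)⟩
    have hec : ge e c := by
      by_contra h2
      linarith [hc.eq_zero e h2, hz' e]
    linarith [le_of_notMem_tail h hq hz' he' hec, hgap e c h1, hlow c]
  have hlt : ∀ e ∈ head ge q z, z' e < z e := fun e he =>
    lt_of_mem_head h hq hz' hz (hs'.trans hs.symm) ht hne he
  have hconst : ∀ d ∈ head ge q z, ∀ e ∈ head ge q z, z' d = z' e := by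
    have hle : ∀ d ∈ head ge q z, ∀ e ∈ head ge q z, ge d e := fun d hd e he =>
      ge_of_notMem_tail h hq hz (notMem_tail_of_mem_head h hq hz he)
        (pos_of_mem_head h hq hz hd)
    have hnt : ∀ e ∈ head ge q z, e ∉ tail ge q z' := fun e he h1 =>
      (ht e h1).not_gt (hlt e he)
    exact fun d hd e he =>
      eq_of_notMem_tail h hq hz' (hnt d hd) (hnt e he) (hle d hd e he) (hle e he d hd)
  refine ⟨(head_tail_eq_of_close h hq hz hz' hs hs' hclose hpos hgap hconst
    fun e he hze => ?_).2, hdec, hconst⟩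
  by_contra h1
  have h2 : 0 < z' e := lt_of_le_of_ne (hz' e) (Ne.symm h1)
  exact he (mem_tail_of_lt h hq hz' hz hs'.le ht (hze.trans_lt h2))

/-- The tail after a uniform increase on a part `D` of a tie outside the tail and decreases
elsewhere. -/
theorem mem_tail_of_raise (h : IsWeakOrder ge) (hq : 0 < q) (hz : ∀ e, 0 ≤ z e)
    (hz' : ∀ e, 0 ≤ z' e) (hs' : ∑ e, z' e = q) {D : Set ι} {φ : ℝ} (hφ : 0 < φ)
    (hraise : ∀ e ∈ D, z' e = z e + φ) (hlow : ∀ e ∉ D, z' e ≤ z e)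
    (hD : ∀ e ∈ D, e ∉ tail ge q z) (htie : ∀ d ∈ D, ∀ e ∈ D, ge d e) (hd : d ∈ D) :
    e ∈ tail ge q z' ↔ ge e d ∧ e ∉ D := by
  have hlt : ∀ e, ge d e → e ∉ D → z' e < z' d := fun e h1 h2 => by
    linarith [le_of_notMem_tail h hq hz (hD d hd) h1, hlow e h2, hraise d hd]
  have heq : ∀ e ∈ D, z' e = z' d := fun e he => by
    rw [hraise e he, hraise d hd, eq_of_notMem_tail h hq hz (hD e he) (hD d hd)
      (htie e he d hd) (htie d hd e he)]
  -- Edges of `D` were outside the tail, hence already maximal among the edges no better; being the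
  -- only ones raised, they become the new head.
  have hcut : IsCut ge z' d := by
    refine ⟨by linarith [hraise d hd, hz d], fun e he => ?_, fun e he => ?_⟩
    · by_cases h1 : e ∈ D
      exacts [(heq e h1).le, (hlt e he h1).le]
    · have h1 : e ∉ D := fun h2 => he (htie e h2 d hd)
      have h2 : ¬ 0 < z e := fun h3 => he (ge_of_notMem_tail h hq hz (hD d hd) h3)
      exact le_antisymm ((hlow e h1).trans (not_lt.1 h2)) (hz' e)
  rw [hcut.mem_tail_iff h hz' hs']
  refine and_congr_right fun _ => ⟨fun h2 h3 => ?_, fun h2 h3 => hlt e h3 h2⟩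
  exact (h2 (htie d hd e h3)).ne (heq e h3)

end MixedChoice
end

/-! ### The graph: stability, polarity and potential heads -/

noncomputable section

namespace MixedProblem

open scoped Classical

variable {F W : Type*} (P : MixedProblem F W) {x y : P.Edge → ℝ} {v : F ⊕ W} {f : F} {w : W}
  {e : P.Edge}

theorem isWeakOrder (v : F ⊕ W) : MixedChoice.IsWeakOrder (P.ge v) :=
  ⟨fun h h' => P.ge_trans v _ _ _ h h', P.ge_total v⟩

variable {P}

theorem mem_tail_val (e : P.Star v) :
    e.1 ∈ P.tail x v ↔ e ∈ MixedChoice.tail (P.ge v) (P.q v) (P.restr x v) := by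
  simp only [tail, Finset.mem_image]
  exact ⟨fun ⟨a, ha, hae⟩ => Subtype.ext hae ▸ ha, fun h => ⟨e, h, rfl⟩⟩

theorem mem_head_val (e : P.Star v) :
    e.1 ∈ P.head x v ↔ e ∈ MixedChoice.head (P.ge v) (P.q v) (P.restr x v) := by
  simp only [head, Finset.mem_image]
  exact ⟨fun ⟨a, ha, hae⟩ => Subtype.ext hae ▸ ha, fun h => ⟨e, h, rfl⟩⟩

theorem incident_of_mem_head (he : e ∈ P.head x v) : Incident v e.1 := by
  simp only [head, Finset.mem_image] at he
  obtain ⟨a, -, rfl⟩ := he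
  exact a.2

theorem mem_tail_of_deficit (hv : ¬ P.FullyFilled x v) (e : P.Star v) : e.1 ∈ P.tail x v := by
  rw [mem_tail_val, MixedChoice.tail_of_ne hv]
  exact Finset.mem_univ e

theorem fullyFilled_of_mem_head (he : e ∈ P.head x v) : P.FullyFilled x v :=
  MixedChoice.sum_eq_of_mem_head ((mem_head_val ⟨e, incident_of_mem_head he⟩).1 he)

/-! ### Admissible and stable assignments -/

variable (P) in
/-- Members of the box respecting the quotas. -/
structure Admissible (x : P.Edge → ℝ) : Prop where
  nonneg : ∀ e, 0 ≤ x e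
  le : ∀ e, x e ≤ P.b e
  sum_le : ∀ v, ∑ e, P.restr x v e ≤ P.q v

variable (P) in
theorem mem_stable_iff (x : P.Edge → ℝ) : x ∈ P.stable ↔ P.Admissible x ∧
    ∀ e, x e < P.b e → e ∈ P.tail x (Sum.inl (P.firm e)) →
      e ∉ P.tail x (Sum.inr (P.worker e)) := by
  have key : P.Admissible x → ∀ e, P.Blocking x e ↔ x e < P.b e ∧
      e ∈ P.tail x (Sum.inl (P.firm e)) ∧ e ∈ P.tail x (Sum.inr (P.worker e)) := by
    intro hx e
    have hbox : ∀ v, P.restr x v ∈ MixedChoice.box (P.restr P.b v) := fun v a =>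
      ⟨hx.nonneg a.1, hx.le a.1⟩
    rw [Blocking,
      MixedChoice.interesting_iff (P.isWeakOrder _) (P.q_pos _) (hbox _) (hx.sum_le _),
      MixedChoice.interesting_iff (P.isWeakOrder _) (P.q_pos _) (hbox _) (hx.sum_le _),
      ← mem_tail_val, ← mem_tail_val]
    change (x e < P.b e ∧ _) ∧ (x e < P.b e ∧ _) ↔ _
    exact ⟨fun h => ⟨h.1.1, h.1.2, h.2.2⟩, fun h => ⟨⟨h.1, h.2.1⟩, h.1, h.2.2⟩⟩
  constructor
  · rintro ⟨hbox, hst, hbl⟩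
    have hx : P.Admissible x := ⟨fun e => (hbox e).1, fun e => (hbox e).2, fun v =>
      ((MixedChoice.mem_stationary_iff (P.isWeakOrder v) (P.q_pos v)).1 (hst v)).2⟩
    exact ⟨hx, fun e h1 h2 h3 => hbl e ((key hx e).2 ⟨h1, h2, h3⟩)⟩
  · rintro ⟨hx, hbl⟩
    refine ⟨fun e => ⟨hx.nonneg e, hx.le e⟩, fun v => ?_, fun e he => ?_⟩
    · exact (MixedChoice.mem_stationary_iff (P.isWeakOrder v) (P.q_pos v)).2
        ⟨fun a => ⟨hx.nonneg a.1, hx.le a.1⟩, hx.sum_le v⟩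
    · obtain ⟨h1, h2, h3⟩ := (key hx e).1 he
      exact hbl e h1 h2 h3

theorem admissible_of_mem_stable (hx : x ∈ P.stable) : P.Admissible x :=
  ((P.mem_stable_iff x).1 hx).1

theorem notMem_tail_firm (hx : x ∈ P.stable) (h : x e < P.b e)
    (hw : e ∈ P.tail x (Sum.inr (P.worker e))) : e ∉ P.tail x (Sum.inl (P.firm e)) :=
  fun hf => ((P.mem_stable_iff x).1 hx).2 e h hf hw

theorem Admissible.restr_nonneg (hx : P.Admissible x) (v : F ⊕ W) (e : P.Star v) :
    0 ≤ P.restr x v e := hx.nonneg e.1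

theorem Admissible.head_nonempty (hx : P.Admissible x) (hv : P.FullyFilled x v) :
    (P.head x v).Nonempty :=
  (MixedChoice.head_nonempty (P.isWeakOrder v) (P.q_pos v) (hx.restr_nonneg v) hv).image _

theorem Admissible.pos_of_mem_head (hx : P.Admissible x) (he : e ∈ P.head x v) : 0 < x e :=
  MixedChoice.pos_of_mem_head (z := P.restr x v) (P.isWeakOrder v) (P.q_pos v)
    (hx.restr_nonneg v) ((mem_head_val ⟨e, incident_of_mem_head he⟩).1 he)

theorem Admissible.notMem_tail_of_mem_head (hx : P.Admissible x) (he : e ∈ P.head x v) :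
    e ∉ P.tail x v := by
  have h := incident_of_mem_head he
  change (⟨e, h⟩ : P.Star v).1 ∉ _
  rw [mem_tail_val]
  exact MixedChoice.notMem_tail_of_mem_head (P.isWeakOrder v) (P.q_pos v) (hx.restr_nonneg v)
    ((mem_head_val ⟨e, h⟩).1 he)

/-! ### Preferences -/

variable (P) in
/-- `y ≤ x` on the tail of `x` at `v`. -/
def Dominates (v : F ⊕ W) (x y : P.Edge → ℝ) : Prop :=
  ∀ e : P.Star v, e.1 ∈ P.tail x v → y e.1 ≤ x e.1

theorem Admissible.prefers_iff (hx : P.Admissible x) (y : P.Edge → ℝ) (v : F ⊕ W) :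
    MixedChoice.Prefers (P.ge v) (P.q v) (P.restr x v) (P.restr y v) ↔ P.Dominates v x y := by
  rw [MixedChoice.prefers_iff (P.isWeakOrder v) (P.q_pos v) (hx.restr_nonneg v) (hx.sum_le v)]
  exact forall_congr' fun e => by rw [← mem_tail_val]; rfl

theorem Admissible.prefersF_iff (hx : P.Admissible x) (y : P.Edge → ℝ) :
    P.PrefersF x y ↔ ∀ f, P.Dominates (Sum.inl f) x y :=
  forall_congr' fun f => hx.prefers_iff y (Sum.inl f)

theorem Dominates.agent (h : P.Dominates v x y) :
    ∀ e ∈ MixedChoice.tail (P.ge v) (P.q v) (P.restr x v), P.restr y v e ≤ P.restr x v e :=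
  fun e he => h e ((mem_tail_val e).2 he)

theorem Dominates.mem_tail_of_lt (hx : P.Admissible x) (hy : P.Admissible y)
    (h : P.Dominates v x y) (e : P.Star v) (he : y e.1 < x e.1) : e.1 ∈ P.tail y v :=
  (mem_tail_val e).2 (MixedChoice.mem_tail_of_lt (P.isWeakOrder v) (P.q_pos v)
    (hx.restr_nonneg v) (hy.restr_nonneg v) (hx.sum_le v) h.agent he)

theorem Dominates.sum_le (hy : P.Admissible y) (h : P.Dominates v x y) :
    ∑ e, P.restr y v e ≤ ∑ e, P.restr x v e := by
  by_cases hv : P.FullyFilled x v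
  · exact (hy.sum_le v).trans_eq hv.symm
  · exact Finset.sum_le_sum fun e _ => h e (mem_tail_of_deficit hv e)

/-- Polarity: preference for `F` implies the opposite preference for `W`. -/
theorem dominates_worker (hx : P.Admissible x) (hy : y ∈ P.stable)
    (h : ∀ f, P.Dominates (Sum.inl f) x y) (w : W) : P.Dominates (Sum.inr w) y x := by
  rintro ⟨e, rfl⟩ he
  by_contra! hlt
  -- Where `y` is below `x`, the edge is unsaturated by `y` and in the firm's tail under `y`, so
  -- stability of `y` keeps it out of the worker's tail.
  exact ((P.mem_stable_iff y).1 hy).2 e (hlt.trans_le (hx.le e))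
    ((h (P.firm e)).mem_tail_of_lt hx (admissible_of_mem_stable hy) (P.atFirm e) hlt) he

theorem sum_star (v : F ⊕ W) (g : P.Edge → ℝ) :
    ∑ e : P.Star v, g e.1 = ∑ e with Incident v e.1, g e :=
  (Finset.sum_subtype (p := fun e : P.Edge => Incident v e.1) _ (by simp) g).symm

theorem sum_sum_firm [Fintype F] (g : P.Edge → ℝ) :
    ∑ f : F, ∑ e with P.firm e = f, g e = ∑ e, g e :=
  Finset.sum_fiberwise _ _ _

theorem sum_sum_worker [Fintype W] (g : P.Edge → ℝ) :
    ∑ w : W, ∑ e with P.worker e = w, g e = ∑ e, g e :=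
  Finset.sum_fiberwise _ _ _

/-- From `x` to `y` totals can only fall at firms and, by polarity, only rise at workers. Both
families add up to the total over all edges, so every inequality is an equality. -/
theorem sum_restr_eq [Fintype F] [Fintype W] (hx : P.Admissible x) (hy : y ∈ P.stable)
    (h : ∀ f, P.Dominates (Sum.inl f) x y) (v : F ⊕ W) :
    ∑ e, P.restr x v e = ∑ e, P.restr y v e := by
  have hy' := admissible_of_mem_stable hy
  have hF : ∀ f ∈ Finset.univ, ∑ e, P.restr y (Sum.inl f) e ≤ ∑ e, P.restr x (Sum.inl f) e :=
    fun f _ => (h f).sum_le hy'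
  have hW : ∀ w ∈ Finset.univ, ∑ e, P.restr x (Sum.inr w) e ≤ ∑ e, P.restr y (Sum.inr w) e :=
    fun w _ => (dominates_worker hx hy h w).sum_le hx
  have tF : ∀ g : P.Edge → ℝ, ∑ f, ∑ e, P.restr g (Sum.inl f) e = ∑ e, g e := fun g => by
    rw [← sum_sum_firm g]
    exact Finset.sum_congr rfl fun f _ => sum_star (Sum.inl f) g
  have tW : ∀ g : P.Edge → ℝ, ∑ w, ∑ e, P.restr g (Sum.inr w) e = ∑ e, g e := fun g => by
    rw [← sum_sum_worker g]
    exact Finset.sum_congr rfl fun w _ => sum_star (Sum.inr w) g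
  have h1 := Finset.sum_le_sum hF
  have h2 := Finset.sum_le_sum hW
  rw [tF, tF] at h1
  rw [tW, tW] at h2
  cases v with
  | inl f =>
    refine ((Finset.sum_eq_sum_iff_of_le hF).1 ?_ f (Finset.mem_univ f)).symm
    rw [tF, tF]
    exact le_antisymm h1 h2
  | inr w =>
    refine (Finset.sum_eq_sum_iff_of_le hW).1 ?_ w (Finset.mem_univ w)
    rw [tW, tW]
    exact le_antisymm h2 h1

theorem Dominates.eq_of_deficit (h : P.Dominates v x y)
    (hs : ∑ e, P.restr x v e = ∑ e, P.restr y v e) (hv : ¬ P.FullyFilled x v)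
    (e : P.Star v) : y e.1 = x e.1 :=
  (Finset.sum_eq_sum_iff_of_le fun e _ => h e (mem_tail_of_deficit hv e)).1 hs.symm e
    (Finset.mem_univ e)

theorem tail_congr (h : ∀ e : P.Star v, x e.1 = y e.1) : P.tail x v = P.tail y v := by
  have : P.restr x v = P.restr y v := funext h
  rw [tail, tail, this]

/-! ### Potential heads -/

variable (P) in
/-- `e` is unsaturated and lies in the tail at its end in `W`. -/
def Raisable (x : P.Edge → ℝ) (e : P.Edge) : Prop :=
  x e < P.b e ∧ e ∈ P.tail x (Sum.inr (P.worker e))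

theorem Raisable.notMem_tail (hx : x ∈ P.stable) (h : P.Raisable x e) :
    e ∉ P.tail x (Sum.inl (P.firm e)) := notMem_tail_firm hx h.1 h.2

theorem mem_potentialHead_val (e : P.Star (Sum.inl f)) : e.1 ∈ P.potentialHead x f ↔
    P.FullyFilled x (Sum.inl f) ∧ P.Candidate x f e ∧
      ∀ e', P.Candidate x f e' → P.ge (Sum.inl f) e e' := by
  simp only [potentialHead, Finset.mem_image, Finset.mem_filter, Finset.mem_univ, true_and]
  exact ⟨fun ⟨a, ha, hae⟩ => Subtype.ext hae ▸ ha, fun h => ⟨e, h, rfl⟩⟩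

theorem firm_eq_of_mem_potentialHead (he : e ∈ P.potentialHead x f) : P.firm e = f := by
  simp only [potentialHead, Finset.mem_image] at he
  obtain ⟨a, -, rfl⟩ := he
  exact a.2

theorem fullyFilled_of_mem_potentialHead (he : e ∈ P.potentialHead x f) :
    P.FullyFilled x (Sum.inl f) :=
  ((mem_potentialHead_val ⟨e, firm_eq_of_mem_potentialHead he⟩).1 he).1

theorem raisable_of_mem_potentialHead (he : e ∈ P.potentialHead x f) : P.Raisable x e :=
  ((mem_potentialHead_val ⟨e, firm_eq_of_mem_potentialHead he⟩).1 he).2.1.1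

theorem worker_fullyFilled_of_mem_potentialHead (he : e ∈ P.potentialHead x f) :
    P.FullyFilled x (Sum.inr (P.worker e)) := by
  have h := ((mem_potentialHead_val ⟨e, firm_eq_of_mem_potentialHead he⟩).1 he).2.1
  exact h.2 _ ((P.isWeakOrder _).refl _) h.1.1

/-- The potential head is best even among all raisable edges: one strictly better than `d` would
inherit the condition on deficit workers from `d` and thus be a better candidate. -/
theorem ge_of_mem_potentialHead {d a : P.Star (Sum.inl f)} (hd : d.1 ∈ P.potentialHead x f)
    (ha : P.Raisable x a.1) : P.ge (Sum.inl f) d a := by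
  obtain ⟨-, h1, h2⟩ := (mem_potentialHead_val d).1 hd
  by_contra hda
  have had := (P.isWeakOrder _).of_not hda
  exact hda (h2 a ⟨ha, fun e' he' => h1.2 e' (P.ge_trans _ _ _ _ he' had)⟩)

theorem mem_potentialHead_of_ge {d a : P.Star (Sum.inl f)} (hd : d.1 ∈ P.potentialHead x f)
    (ha : P.Raisable x a.1) (had : P.ge (Sum.inl f) a d) : a.1 ∈ P.potentialHead x f := by
  obtain ⟨h0, h1, h2⟩ := (mem_potentialHead_val d).1 hd
  exact (mem_potentialHead_val a).2 ⟨h0, ⟨ha, fun e' he' => h1.2 e' (P.ge_trans _ _ _ _ he' had)⟩,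
    fun e' he' => P.ge_trans _ _ _ _ had (h2 e' he')⟩

theorem mem_potentialHead_of_best {a : P.Star (Sum.inl f)} (hf : P.FullyFilled x (Sum.inl f))
    (ha : P.Raisable x a.1)
    (hbest : ∀ a' : P.Star (Sum.inl f), P.Raisable x a'.1 → P.ge (Sum.inl f) a a')
    (hfull : ∀ a' : P.Star (Sum.inl f), P.Raisable x a'.1 → P.ge (Sum.inl f) a' a →
      P.FullyFilled x (Sum.inr (P.worker a'.1))) : a.1 ∈ P.potentialHead x f := by
  refine (mem_potentialHead_val a).2 ⟨hf, ⟨ha, fun e' he' hu => ?_⟩, fun e' he' => hbest e' he'.1⟩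
  -- Only raisable edges need checking: an unsaturated edge at a deficit worker is raisable, since
  -- that worker's tail is its whole star.
  by_contra hdef
  exact hdef (hfull e' ⟨hu, mem_tail_of_deficit hdef (P.atWorker e'.1)⟩ he')

theorem notMem_head_of_mem_potentialHead (hx : P.Admissible x) (he : e ∈ P.potentialHead x f) :
    e ∉ P.head x (Sum.inr (P.worker e)) := fun h =>
  hx.notMem_tail_of_mem_head h (raisable_of_mem_potentialHead he).2

/-- The values are equal on a potential head. -/
theorem eq_of_mem_potentialHead (hy : P.Admissible y)
    (hty : ∀ a : P.Star (Sum.inl f), P.Raisable x a.1 → a.1 ∉ P.tail y (Sum.inl f))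
    {d e : P.Edge} (hd : d ∈ P.potentialHead x f)
    (he : e ∈ P.potentialHead x f) : y d = y e := by
  have hd1 := firm_eq_of_mem_potentialHead hd
  have he1 := firm_eq_of_mem_potentialHead he
  have hd2 := raisable_of_mem_potentialHead hd
  have he2 := raisable_of_mem_potentialHead he
  exact MixedChoice.eq_of_notMem_tail (P.isWeakOrder (Sum.inl f)) (P.q_pos _)
    (hy.restr_nonneg (Sum.inl f)) (d := ⟨d, hd1⟩) (e := ⟨e, he1⟩)
    (fun h => hty ⟨d, hd1⟩ hd2 ((mem_tail_val _).2 h))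
    (fun h => hty ⟨e, he1⟩ he2 ((mem_tail_val _).2 h))
    (ge_of_mem_potentialHead (d := ⟨d, hd1⟩) hd he2)
    (ge_of_mem_potentialHead (d := ⟨e, he1⟩) he hd2)

/-! ### Gaps -/

variable (P) in
/-- `2η` bounds from below the positive values, differences and residual capacities. -/
structure IsGap (x : P.Edge → ℝ) (η : ℝ) : Prop where
  pos : 0 < η
  le : ∀ e, 0 < x e → 2 * η ≤ x e
  le_sub : ∀ d e, x d < x e → 2 * η ≤ x e - x d
  le_cap : ∀ e, x e < P.b e → 2 * η ≤ P.b e - x e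

theorem exists_pos_forall_le {ι : Type*} [Finite ι] (g : ι → ℝ) :
    ∃ η : ℝ, 0 < η ∧ ∀ i, 0 < g i → η ≤ g i := by
  by_cases h : ∃ i, 0 < g i
  · obtain ⟨i, hi⟩ := h
    have := Fintype.ofFinite ι
    obtain ⟨m, hm, hmin⟩ := Finset.exists_min_image (Finset.univ.filter fun i => 0 < g i) g
      ⟨i, by simpa using hi⟩
    simp only [Finset.mem_filter, Finset.mem_univ, true_and] at hm hmin
    exact ⟨g m, hm, hmin⟩
  · exact ⟨1, one_pos, fun i hi => absurd ⟨i, hi⟩ h⟩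

variable (P) in
theorem exists_isGap (x : P.Edge → ℝ) : ∃ η, P.IsGap x η := by
  obtain ⟨α, hα, h1⟩ := exists_pos_forall_le x
  obtain ⟨β, hβ, h2⟩ := exists_pos_forall_le fun a : P.Edge × P.Edge => x a.2 - x a.1
  obtain ⟨γ, hγ, h3⟩ := exists_pos_forall_le fun e => P.b e - x e
  have hm := min_le_left α (min β γ)
  have hm1 := (min_le_right α (min β γ)).trans (min_le_left _ _)
  have hm2 := (min_le_right α (min β γ)).trans (min_le_right _ _)
  refine ⟨min α (min β γ) / 2, half_pos (lt_min hα (lt_min hβ hγ)), fun e he => ?_,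
    fun d e hde => ?_, fun e he => ?_⟩
  · linarith [h1 e he]
  · have := h2 (d, e) (sub_pos.2 hde)
    simp only at this
    linarith
  · linarith [h3 e (sub_pos.2 he)]

end MixedProblem
end

/-! ### Balance vectors as edge vectors -/

noncomputable section

namespace MixedProblem

open scoped Classical

variable {F W : Type*} {P : MixedProblem F W} {x y : P.Edge → ℝ} {v : F ⊕ W} {f : F} {w : W}
  {e : P.Edge} {p : (P.FPlus x → ℝ) × (P.WPlus x → ℝ)}

/-! ### Sums of balance vectors -/

/-- Extension by zero of a function on a subtype. -/
def zeroExtend {α : Type*} {R : α → Prop} (g : {a // R a} → ℝ) (a : α) : ℝ :=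
  if h : R a then g ⟨a, h⟩ else 0

theorem zeroExtend_val {α : Type*} {R : α → Prop} (g : {a // R a} → ℝ) (a : {a // R a}) :
    zeroExtend g a.1 = g a := dif_pos a.2

theorem zeroExtend_of_not {α : Type*} {R : α → Prop} (g : {a // R a} → ℝ) {a : α} (h : ¬ R a) :
    zeroExtend g a = 0 := dif_neg h

theorem zeroExtend_nonneg {α : Type*} {R : α → Prop} {g : {a // R a} → ℝ} (hg : ∀ a, 0 ≤ g a)
    (a : α) : 0 ≤ zeroExtend g a := by
  unfold zeroExtend
  split_ifs
  exacts [hg _, le_rfl]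

theorem sum_zeroExtend {α : Type*} [Fintype α] {R : α → Prop} (g : {a // R a} → ℝ)
    (Q : α → Prop) (k : α → ℝ) :
    ∑ a : {a // R a} with Q a.1, k a.1 * g a = ∑ a with Q a, k a * zeroExtend g a := by
  rw [Finset.sum_filter, Finset.sum_filter]
  have h1 : ∑ a with R a, (if Q a then k a * zeroExtend g a else 0) =
      ∑ a : {a // R a}, (if Q a.1 then k a.1 * zeroExtend g a.1 else 0) :=
    Finset.sum_subtype _ (by simp) _
  simp only [zeroExtend_val] at h1
  rw [← h1, Finset.sum_filter]
  refine Finset.sum_congr rfl fun a _ => ?_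
  split_ifs with h2 h3 h4
  · rfl
  · rfl
  · rw [zeroExtend_of_not g h2, mul_zero]
  · rfl

/-- Since `D_f` and `H_w` are disjoint, the nested cases become a plain difference, which can be
summed around a vertex. -/
theorem Delta_eq (hx : P.Admissible x) (p : (P.FPlus x → ℝ) × (P.WPlus x → ℝ)) (e : P.Edge) :
    P.Delta x p e =
      (if e ∈ P.potentialHead x (P.firm e) then zeroExtend p.1 (P.firm e) else 0) -
        if e ∈ P.head x (Sum.inr (P.worker e)) then zeroExtend p.2 (P.worker e) else 0 := by
  unfold Delta zeroExtend
  by_cases hD : e ∈ P.potentialHead x (P.firm e)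
  · have hH := notMem_head_of_mem_potentialHead hx hD
    by_cases hR : P.Regular x (Sum.inl (P.firm e)) <;> simp [hD, hH, hR]
  · by_cases hH : e ∈ P.head x (Sum.inr (P.worker e)) <;>
      by_cases hR : P.Regular x (Sum.inr (P.worker e)) <;> simp [hD, hH, hR]

theorem Delta_of_mem_potentialHead (hx : P.Admissible x)
    (p : (P.FPlus x → ℝ) × (P.WPlus x → ℝ)) (he : e ∈ P.potentialHead x (P.firm e)) :
    P.Delta x p e = zeroExtend p.1 (P.firm e) := by
  rw [Delta_eq hx, if_pos he, if_neg (notMem_head_of_mem_potentialHead hx he), sub_zero]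

theorem Delta_of_mem_head (hx : P.Admissible x)
    (p : (P.FPlus x → ℝ) × (P.WPlus x → ℝ)) (he : e ∈ P.head x (Sum.inr (P.worker e))) :
    P.Delta x p e = - zeroExtend p.2 (P.worker e) := by
  rw [Delta_eq hx, if_pos he, if_neg, zero_sub]
  exact fun h => notMem_head_of_mem_potentialHead hx h he

theorem Delta_of_notMem (hx : P.Admissible x)
    (p : (P.FPlus x → ℝ) × (P.WPlus x → ℝ)) (hD : e ∉ P.potentialHead x (P.firm e))
    (hH : e ∉ P.head x (Sum.inr (P.worker e))) : P.Delta x p e = 0 := by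
  rw [Delta_eq hx, if_neg hD, if_neg hH, sub_zero]

theorem sum_worker_edgeIn [Fintype W] (S : W → Finset P.Edge) (f : F) (g : W → ℝ) :
    ∑ w with P.EdgeIn (S w) f w, g w =
      ∑ e : P.Edge with P.firm e = f, if e ∈ S (P.worker e) then g (P.worker e) else 0 := by
  rw [← Finset.sum_filter, Finset.filter_filter]
  symm
  refine Finset.sum_bij (fun e _ => P.worker e) ?_ ?_ ?_ fun _ _ => rfl
  · rintro e he
    obtain ⟨h1, h2⟩ := (Finset.mem_filter.1 he).2
    subst h1
    exact Finset.mem_filter.2 ⟨Finset.mem_univ _, e.2, h2⟩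
  · intro e he e' he' h
    have h1 := (Finset.mem_filter.1 he).2.1
    have h2 := (Finset.mem_filter.1 he').2.1
    exact Subtype.ext (Prod.ext (h1.trans h2.symm) h)
  · intro w hw
    obtain ⟨h1, h2⟩ := (Finset.mem_filter.1 hw).2
    exact ⟨⟨(f, w), h1⟩, Finset.mem_filter.2 ⟨Finset.mem_univ _, rfl, h2⟩, rfl⟩

theorem sum_firm_edgeIn [Fintype F] (S : F → Finset P.Edge) (w : W) (g : F → ℝ) :
    ∑ f with P.EdgeIn (S f) f w, g f =
      ∑ e : P.Edge with P.worker e = w, if e ∈ S (P.firm e) then g (P.firm e) else 0 := by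
  rw [← Finset.sum_filter, Finset.filter_filter]
  symm
  refine Finset.sum_bij (fun e _ => P.firm e) ?_ ?_ ?_ fun _ _ => rfl
  · rintro e he
    obtain ⟨h1, h2⟩ := (Finset.mem_filter.1 he).2
    subst h1
    exact Finset.mem_filter.2 ⟨Finset.mem_univ _, e.2, h2⟩
  · intro e he e' he' h
    have h1 := (Finset.mem_filter.1 he).2.1
    have h2 := (Finset.mem_filter.1 he').2.1
    exact Subtype.ext (Prod.ext h (h1.trans h2.symm))
  · intro f hf
    obtain ⟨h1, h2⟩ := (Finset.mem_filter.1 hf).2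
    exact ⟨⟨(f, w), h1⟩, Finset.mem_filter.2 ⟨Finset.mem_univ _, rfl, h2⟩, rfl⟩

theorem sum_firm_potentialHead (x : P.Edge → ℝ) (f : F) (g : F → ℝ) :
    ∑ e with P.firm e = f, (if e ∈ P.potentialHead x (P.firm e) then g (P.firm e) else 0) =
      (P.potentialHead x f).card * g f := by
  rw [← Finset.sum_filter, Finset.filter_filter]
  have h1 : (Finset.univ.filter fun e : P.Edge => P.firm e = f ∧
      e ∈ P.potentialHead x (P.firm e)) = P.potentialHead x f := by
    ext e
    simp only [Finset.mem_filter, Finset.mem_univ, true_and]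
    refine ⟨fun ⟨h, h'⟩ => h ▸ h', fun h => ?_⟩
    have h2 := firm_eq_of_mem_potentialHead h
    exact ⟨h2, h2.symm ▸ h⟩
  rw [h1, Finset.sum_congr rfl fun e he => by rw [firm_eq_of_mem_potentialHead he],
    Finset.sum_const, nsmul_eq_mul]

theorem sum_worker_head (x : P.Edge → ℝ) (w : W) (g : W → ℝ) :
    ∑ e with P.worker e = w,
      (if e ∈ P.head x (Sum.inr (P.worker e)) then g (P.worker e) else 0) =
      (P.head x (Sum.inr w)).card * g w := by
  rw [← Finset.sum_filter, Finset.filter_filter]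
  have h1 : (Finset.univ.filter fun e : P.Edge => P.worker e = w ∧
      e ∈ P.head x (Sum.inr (P.worker e))) = P.head x (Sum.inr w) := by
    ext e
    simp only [Finset.mem_filter, Finset.mem_univ, true_and]
    refine ⟨fun ⟨h, h'⟩ => h ▸ h', fun h => ?_⟩
    have h2 : P.worker e = w := incident_of_mem_head h
    exact ⟨h2, h2.symm ▸ h⟩
  rw [h1, Finset.sum_congr rfl fun e he => by
    rw [show P.worker e = w from incident_of_mem_head he], Finset.sum_const, nsmul_eq_mul]

theorem sum_firm_Delta [Fintype W] (hx : P.Admissible x) (p : (P.FPlus x → ℝ) × (P.WPlus x → ℝ))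
    (f : P.FPlus x) : ∑ e with P.firm e = f.1, P.Delta x p e =
      ((P.potentialHead x f.1).card : ℝ) * p.1 f -
        ∑ w : P.WPlus x with P.EdgeIn (P.head x (Sum.inr w.1)) f.1 w.1, p.2 w := by
  have h1 := sum_zeroExtend p.2 (fun w => P.EdgeIn (P.head x (Sum.inr w)) f.1 w) fun _ => 1
  simp only [one_mul] at h1
  rw [h1, sum_worker_edgeIn (fun w => P.head x (Sum.inr w)), ← zeroExtend_val p.1 f,
    ← sum_firm_potentialHead, ← Finset.sum_sub_distrib]
  exact Finset.sum_congr rfl fun e _ => Delta_eq hx p e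

theorem sum_worker_Delta [Fintype F] (hx : P.Admissible x) (p : (P.FPlus x → ℝ) × (P.WPlus x → ℝ))
    (w : P.WPlus x) : ∑ e with P.worker e = w.1, P.Delta x p e =
      ∑ f : P.FPlus x with P.EdgeIn (P.potentialHead x f.1) f.1 w.1, p.1 f -
        ((P.head x (Sum.inr w.1)).card : ℝ) * p.2 w := by
  have h1 := sum_zeroExtend p.1 (fun f => P.EdgeIn (P.potentialHead x f) f w.1) fun _ => 1
  simp only [one_mul] at h1
  rw [h1, sum_firm_edgeIn (fun f => P.potentialHead x f), ← zeroExtend_val p.2 w,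
    ← sum_worker_head, ← Finset.sum_sub_distrib]
  exact Finset.sum_congr rfl fun e _ => Delta_eq hx p e

theorem Regular.potentialHead_nonempty (h : P.Regular x (Sum.inl f)) :
    (P.potentialHead x f).Nonempty := by
  by_contra hD
  exact h.2 (Singular.ofFirm f h.1 (Finset.not_nonempty_iff_eq_empty.1 hD))

theorem firm_regular_of_mem_head (he : e ∈ P.head x (Sum.inr w)) (hw : P.Regular x (Sum.inr w)) :
    P.Regular x (Sum.inl (P.firm e)) := by
  refine ⟨?_, fun hs => hw.2 (Singular.step _ (Sum.inl (P.firm e)) e hw.1 he rfl hs)⟩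
  by_contra hd
  exact hw.2 (Singular.ofWorker w e hw.1 he hd)

theorem worker_regular_of_mem_potentialHead (he : e ∈ P.potentialHead x f)
    (hf : P.Regular x (Sum.inl f)) : P.Regular x (Sum.inr (P.worker e)) :=
  ⟨worker_fullyFilled_of_mem_potentialHead he, fun hs =>
    hf.2 (Singular.step _ (Sum.inr (P.worker e)) e hf.1 he rfl hs)⟩

/-- A regular worker has only regular firms across its head, so a non-regular firm also kills the
worker's contribution. -/
theorem Delta_of_firm_not_regular (hx : P.Admissible x)
    (hf : ¬ P.Regular x (Sum.inl (P.firm e))) : P.Delta x p e = 0 := by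
  rw [Delta_eq hx, zeroExtend_of_not p.1 hf, ite_self, zero_sub, neg_eq_zero]
  split_ifs with h
  · exact zeroExtend_of_not _ fun hw => hf (firm_regular_of_mem_head h hw)
  · rfl

theorem Delta_of_worker_not_regular (hx : P.Admissible x)
    (hw : ¬ P.Regular x (Sum.inr (P.worker e))) : P.Delta x p e = 0 := by
  rw [Delta_eq hx, zeroExtend_of_not p.2 hw, ite_self, sub_zero]
  split_ifs with h
  · exact zeroExtend_of_not _ fun hf => hw (worker_regular_of_mem_potentialHead h hf)
  · rfl

section Balance

variable [Fintype F] [Fintype W]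

theorem sum_abs_Delta (hx : P.Admissible x) (h1 : ∀ f, 0 ≤ p.1 f) (h2 : ∀ w, 0 ≤ p.2 w) :
    ∑ e, |P.Delta x p e| =
      ∑ f : P.FPlus x, ((P.potentialHead x f.1).card : ℝ) * p.1 f +
        ∑ w : P.WPlus x, ((P.head x (Sum.inr w.1)).card : ℝ) * p.2 w := by
  have hF := sum_zeroExtend p.1 (fun _ => True) fun f => ((P.potentialHead x f).card : ℝ)
  have hW := sum_zeroExtend p.2 (fun _ => True) fun w => ((P.head x (Sum.inr w)).card : ℝ)
  simp only [Finset.filter_true] at hF hW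
  rw [hF, hW]
  simp only [← sum_firm_potentialHead, ← sum_worker_head, sum_sum_firm, sum_sum_worker]
  rw [← Finset.sum_add_distrib]
  refine Finset.sum_congr rfl fun e _ => ?_
  by_cases hD : e ∈ P.potentialHead x (P.firm e)
  · rw [Delta_of_mem_potentialHead hx p hD, if_pos hD,
      if_neg (notMem_head_of_mem_potentialHead hx hD), add_zero,
      abs_of_nonneg (zeroExtend_nonneg h1 _)]
  · by_cases hH : e ∈ P.head x (Sum.inr (P.worker e))
    · rw [Delta_of_mem_head hx p hH, if_neg hD, if_pos hH, zero_add, abs_neg,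
        abs_of_nonneg (zeroExtend_nonneg h2 _)]
    · rw [Delta_of_notMem hx p hD hH, if_neg hD, if_neg hH, abs_zero, add_zero]

/-- The balance system is a statement about `Δ` alone: zero net change at regular vertices and `ℓ¹`
norm `ε`. -/
theorem mem_balancePolytope_iff (hx : P.Admissible x)
    (p : (P.FPlus x → ℝ) × (P.WPlus x → ℝ)) (ε : ℝ) : p ∈ P.balancePolytope x ε ↔
      (∀ f : P.FPlus x, ∑ e with P.firm e = f.1, P.Delta x p e = 0) ∧
      (∀ w : P.WPlus x, ∑ e with P.worker e = w.1, P.Delta x p e = 0) ∧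
      ∑ e, |P.Delta x p e| = ε ∧ (∀ f, 0 ≤ p.1 f) ∧ ∀ w, 0 ≤ p.2 w := by
  simp only [sum_firm_Delta hx, sum_worker_Delta hx]
  constructor
  · rintro ⟨h1, h2, h3, h4, h5⟩
    refine ⟨h1, fun w => ?_, ?_, h4, h5⟩
    · linarith [h2 w]
    · rw [sum_abs_Delta hx h4 h5, h3]
  · rintro ⟨h1, h2, h3, h4, h5⟩
    refine ⟨h1, fun w => ?_, ?_, h4, h5⟩
    · linarith [h2 w]
    · rw [← sum_abs_Delta hx h4 h5, h3]

theorem sum_restr_Delta {ε : ℝ} (hx : P.Admissible x) (hp : p ∈ P.balancePolytope x ε)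
    (v : F ⊕ W) : ∑ e, P.restr (P.Delta x p) v e = 0 := by
  obtain ⟨h1, h2, -⟩ := (mem_balancePolytope_iff hx p ε).1 hp
  rw [show ∑ e, P.restr (P.Delta x p) v e = ∑ e with Incident v e.1, P.Delta x p e from
    sum_star v _]
  by_cases hv : P.Regular x v
  · cases v with
    | inl f => exact h1 ⟨f, hv⟩
    | inr w => exact h2 ⟨w, hv⟩
  · refine Finset.sum_eq_zero fun e he => ?_
    have hi := (Finset.mem_filter.1 he).2
    cases v with
    | inl f => exact Delta_of_firm_not_regular hx fun h => hv (by rwa [← show e.1.1 = f from hi])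
    | inr w => exact Delta_of_worker_not_regular hx fun h => hv (by rwa [← show e.1.2 = w from hi])

/-- Regular vertices have nonempty `D_f` or `H_w`, so each coordinate is, up to sign, an entry of
`Δ` and is bounded by `ε`. -/
theorem isBounded_balancePolytope (hx : P.Admissible x) (ε : ℝ) :
    Bornology.IsBounded (P.balancePolytope x ε) := by
  refine (Metric.isBounded_closedBall (x := (0 : (P.FPlus x → ℝ) × (P.WPlus x → ℝ)))
    (r := max ε 0)).subset fun p hp => ?_
  obtain ⟨-, -, h3, h4, h5⟩ := (mem_balancePolytope_iff hx p ε).1 hp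
  have hle : ∀ e, |P.Delta x p e| ≤ ε := fun e =>
    (Finset.single_le_sum (f := fun e => |P.Delta x p e|) (fun e _ => abs_nonneg _)
      (Finset.mem_univ e)).trans_eq h3
  rw [mem_closedBall_zero_iff, Prod.norm_def]
  refine max_le ?_ ?_ <;> refine (pi_norm_le_iff_of_nonneg (le_max_right _ _)).2 fun a => ?_
  · obtain ⟨e, he⟩ := a.2.potentialHead_nonempty
    have h6 := firm_eq_of_mem_potentialHead he
    have h7 := Delta_of_mem_potentialHead hx p (h6.symm ▸ he)
    rw [h6, zeroExtend_val] at h7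
    rw [Real.norm_eq_abs, ← h7]
    exact (hle e).trans (le_max_left _ _)
  · obtain ⟨e, he⟩ := hx.head_nonempty a.2.1
    have h6 : P.worker e = a.1 := incident_of_mem_head he
    have h7 := Delta_of_mem_head hx p (h6.symm ▸ he)
    rw [h6, zeroExtend_val] at h7
    rw [Real.norm_eq_abs, ← abs_neg, ← h7]
    exact (hle e).trans (le_max_left _ _)

end Balance

end MixedProblem
end

/-! ### Part (a): nearby stable assignments and balanced shifts -/

noncomputable section

namespace MixedProblem

open scoped Classical

variable {F W : Type*} [Fintype F] [Fintype W] {P : MixedProblem F W} {x y : P.Edge → ℝ}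
  {v : F ⊕ W} {f : F} {w : W} {e : P.Edge} {p : (P.FPlus x → ℝ) × (P.WPlus x → ℝ)} {η ε : ℝ}

/-! ### Stable assignments close to `x` are balanced shifts -/

section Close

variable (hx : x ∈ P.stable) (hy : y ∈ P.stable) (hxy : ∀ f, P.Dominates (Sum.inl f) x y)
  (hη : P.IsGap x η) (hclose : ∀ e, |y e - x e| < η)

include hx hy hxy

theorem eq_of_not_fullyFilled (hv : ¬ P.FullyFilled x v) (e : P.Star v) : y e.1 = x e.1 := by
  have hs := sum_restr_eq (admissible_of_mem_stable hx) hy hxy v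
  cases v with
  | inl f => exact (hxy f).eq_of_deficit hs hv e
  | inr w =>
    have hd := dominates_worker (admissible_of_mem_stable hx) hy hxy w
    exact (hd.eq_of_deficit hs.symm (fun h => hv (hs.trans h)) e).symm

omit [Fintype F] [Fintype W] in
theorem raisable_of_lt (he : x e < y e) : P.Raisable x e :=
  ⟨he.trans_le ((admissible_of_mem_stable hy).le e),
    (dominates_worker (admissible_of_mem_stable hx) hy hxy (P.worker e)).mem_tail_of_lt
      (admissible_of_mem_stable hy) (admissible_of_mem_stable hx) (P.atWorker e) he⟩

omit [Fintype F] [Fintype W] in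
/-- Increasing edges and raisable edges outside the tail of `y` with at most the value in `x`. -/
theorem not_ge_of_raisable {a d : P.Star (Sum.inl f)} (ha : x a.1 < y a.1)
    (hd : P.Raisable x d.1) (hd' : d.1 ∉ P.tail y (Sum.inl f)) (hdd : y d.1 ≤ x d.1) :
    ¬ P.ge (Sum.inl f) d a := by
  have hdx : d.1 ∉ P.tail x (Sum.inl f) := by
    have := hd.notMem_tail hx
    rwa [show P.firm d.1 = f from d.2] at this
  exact MixedChoice.not_ge_of_lt (z := P.restr x (Sum.inl f)) (z' := P.restr y (Sum.inl f))
    (P.isWeakOrder _) (P.q_pos _) ((admissible_of_mem_stable hx).restr_nonneg _)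
    ((admissible_of_mem_stable hy).restr_nonneg _) (hxy f).agent ha
    (fun h => hdx ((mem_tail_val d).2 h)) (fun h => hd' ((mem_tail_val d).2 h)) hdd

include hη hclose

/-- By polarity `y` is the preferred assignment at `w`, so `tail_eq_of_close` applies at a fully
filled `w`; at a deficit one nothing changes. -/
theorem worker_side (w : W) : P.tail y (Sum.inr w) = P.tail x (Sum.inr w) ∧
    (∀ e : P.Star (Sum.inr w), y e.1 < x e.1 → e.1 ∈ P.head x (Sum.inr w)) ∧
    ∀ d ∈ P.head x (Sum.inr w), ∀ e ∈ P.head x (Sum.inr w), y d - x d = y e - x e := by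
  have hx' := admissible_of_mem_stable hx
  have hy' := admissible_of_mem_stable hy
  by_cases hw : P.FullyFilled x (Sum.inr w)
  · have hs := sum_restr_eq hx' hy hxy (Sum.inr w)
    obtain ⟨h1, h2, h3⟩ := MixedChoice.tail_eq_of_close (P.isWeakOrder (Sum.inr w)) (P.q_pos _)
      (hx'.restr_nonneg _) (hy'.restr_nonneg _) hw (hs.symm.trans hw) (fun e => hclose e.1)
      (fun e => hη.le e.1) (fun d e => hη.le_sub d.1 e.1) (dominates_worker hx' hy hxy w).agent
    refine ⟨by rw [tail, tail, h1], fun e he => (mem_head_val e).2 (h2 e he),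
      fun d hd e he => ?_⟩
    have hd' := (mem_head_val ⟨d, incident_of_mem_head hd⟩).1 hd
    have he' := (mem_head_val ⟨e, incident_of_mem_head he⟩).1 he
    have h4 : y d = y e := h3 _ hd' _ he'
    have h5 : x d = x e := (MixedChoice.eq_cutHeight_of_mem_head hd').trans
      (MixedChoice.eq_cutHeight_of_mem_head he').symm
    rw [h4, h5]
  · have heq := eq_of_not_fullyFilled hx hy hxy hw
    refine ⟨tail_congr heq, fun e he => absurd (heq e) he.ne, fun d hd => ?_⟩
    exact absurd (fullyFilled_of_mem_head hd) hw

/-- The gap keeps `e` unsaturated and the worker's tail is the same under `y`; stability of `y` then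
excludes the firm's tail. -/
theorem notMem_tail_of_raisable (he : P.Raisable x e) : e ∉ P.tail y (Sum.inl (P.firm e)) := by
  refine notMem_tail_firm hy ?_ ?_
  · linarith [(abs_lt.1 (hclose e)).2, hη.le_cap e he.1, hη.pos]
  · rw [(worker_side hx hy hxy hη hclose (P.worker e)).1]
    exact he.2

/-- Raisable edges are outside the firm's tail under `y`, hence no better than `e`, which is in the
support of `y`. One as good as `e` at a deficit worker would keep its value, against
`not_ge_of_raisable`. -/
theorem mem_potentialHead_of_lt (he : x e < y e) : e ∈ P.potentialHead x (P.firm e) := by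
  have hy' := admissible_of_mem_stable hy
  have hnt : ∀ a : P.Star (Sum.inl (P.firm e)), P.Raisable x a.1 →
      a.1 ∉ P.tail y (Sum.inl (P.firm e)) := fun a ha => by
    have := notMem_tail_of_raisable hx hy hxy hη hclose ha
    rwa [show P.firm a.1 = P.firm e from a.2] at this
  have hr := raisable_of_lt hx hy hxy he
  have hpos : 0 < y e := ((admissible_of_mem_stable hx).nonneg e).trans_lt he
  change (P.atFirm e).1 ∈ _
  refine mem_potentialHead_of_best ?_ hr (fun a ha => ?_) fun a ha hge => ?_
  · by_contra hf
    exact he.ne' (eq_of_not_fullyFilled hx hy hxy hf (P.atFirm e))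
  · exact MixedChoice.ge_of_notMem_tail (P.isWeakOrder _) (P.q_pos _) (hy'.restr_nonneg _)
      (fun h => hnt a ha ((mem_tail_val a).2 h)) hpos
  · by_contra hw
    exact not_ge_of_raisable hx hy hxy (a := P.atFirm e) he ha (hnt a ha)
      (eq_of_not_fullyFilled hx hy hxy hw (P.atWorker a.1)).le hge

/-- `D_f` lies in one tie and outside the firm's tail under both `x` and `y`, so both are constant
on it. -/
theorem sub_eq_of_mem_potentialHead {d : P.Edge} (hd : d ∈ P.potentialHead x f)
    (he : e ∈ P.potentialHead x f) : y d - x d = y e - x e := by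
  have aux : ∀ {z : P.Edge → ℝ}, (∀ a, P.Raisable x a → a ∉ P.tail z (Sum.inl (P.firm a))) →
      ∀ a : P.Star (Sum.inl f), P.Raisable x a.1 → a.1 ∉ P.tail z (Sum.inl f) :=
    fun {z} h a ha => by
      have := h a.1 ha
      rwa [show P.firm a.1 = f from a.2] at this
  rw [eq_of_mem_potentialHead (admissible_of_mem_stable hy)
      (aux fun a => notMem_tail_of_raisable hx hy hxy hη hclose) hd he,
    eq_of_mem_potentialHead (admissible_of_mem_stable hx)
      (aux fun a ha => ha.notMem_tail hx) hd he]

theorem le_of_mem_potentialHead (he : e ∈ P.potentialHead x (P.firm e)) : x e ≤ y e := by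
  by_contra! h
  exact notMem_head_of_mem_potentialHead (admissible_of_mem_stable hx) he
    ((worker_side hx hy hxy hη hclose (P.worker e)).2.1 (P.atWorker e) h)

theorem le_of_mem_head (he : e ∈ P.head x (Sum.inr (P.worker e))) : y e ≤ x e := by
  by_contra! h
  exact notMem_head_of_mem_potentialHead (admissible_of_mem_stable hx)
    (mem_potentialHead_of_lt hx hy hxy hη hclose h) he

/-- If an edge of the head of a vertex keeps its value, so do all edges at the vertex. -/
theorem eq_of_eq_on_outHead (h : ∀ e ∈ P.outHead x v, y e = x e) (e : P.Star v) :
    y e.1 = x e.1 := by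
  have hs := sum_restr_eq (admissible_of_mem_stable hx) hy hxy v
  cases v with
  | inl f =>
    have hle : ∀ e ∈ Finset.univ, P.restr y (Sum.inl f) e ≤ P.restr x (Sum.inl f) e := by
      intro a _
      by_contra! hlt
      have h1 := mem_potentialHead_of_lt hx hy hxy hη hclose hlt
      rw [show P.firm a.1 = f from a.2] at h1
      exact hlt.ne' (h a.1 h1)
    exact (Finset.sum_eq_sum_iff_of_le hle).1 hs.symm e (Finset.mem_univ e)
  | inr w =>
    have hle : ∀ e ∈ Finset.univ, P.restr x (Sum.inr w) e ≤ P.restr y (Sum.inr w) e := by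
      intro a _
      by_contra! hlt
      exact hlt.ne (h a.1 ((worker_side hx hy hxy hη hclose w).2.1 a hlt))
    exact ((Finset.sum_eq_sum_iff_of_le hle).1 hs e (Finset.mem_univ e)).symm

/-- Changes are uniform on each head, so one immobile head edge fixes the whole head and then the
whole star. This propagates along the growth of the singular set. -/
theorem eq_of_singular (hv : P.Singular x v) : ∀ e : P.Star v, y e.1 = x e.1 := by
  induction hv with
  | ofWorker w e hw he hd =>
    refine eq_of_eq_on_outHead hx hy hxy hη hclose fun d hd' => ?_
    have h1 := (worker_side hx hy hxy hη hclose w).2.2 d hd' e he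
    have h2 := eq_of_not_fullyFilled hx hy hxy hd (P.atFirm e)
    have h3 : y e = x e := h2
    linarith
  | ofFirm f hf hD =>
    refine eq_of_eq_on_outHead hx hy hxy hη hclose fun d hd' => ?_
    rw [outHead, hD] at hd'
    simp at hd'
  | step v u e hv he hu hs ih =>
    have h1 : y e = x e := ih ⟨e, hu⟩
    refine eq_of_eq_on_outHead hx hy hxy hη hclose fun d hd => ?_
    cases v with
    | inl f => linarith [sub_eq_of_mem_potentialHead hx hy hxy hη hclose hd he]
    | inr w => linarith [(worker_side hx hy hxy hη hclose w).2.2 d hd e he]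

theorem exists_eq_add_Delta (hsum : ∑ e, |y e - x e| = ε) :
    ∃ p ∈ P.balancePolytope x ε, y = x + P.Delta x p := by
  have hx' := admissible_of_mem_stable hx
  have hφ : ∀ f, ∃ φ : ℝ, 0 ≤ φ ∧ ∀ e ∈ P.potentialHead x f, y e - x e = φ := by
    intro f
    by_cases hD : (P.potentialHead x f).Nonempty
    · obtain ⟨d, hd⟩ := hD
      have h1 := firm_eq_of_mem_potentialHead hd
      exact ⟨y d - x d, sub_nonneg.2 (le_of_mem_potentialHead hx hy hxy hη hclose (h1.symm ▸ hd)),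
        fun e he => sub_eq_of_mem_potentialHead hx hy hxy hη hclose he hd⟩
    · exact ⟨0, le_rfl, fun e he => absurd ⟨e, he⟩ hD⟩
  have hψ : ∀ w, ∃ ψ : ℝ, 0 ≤ ψ ∧ ∀ e ∈ P.head x (Sum.inr w), y e - x e = -ψ := by
    intro w
    by_cases hH : (P.head x (Sum.inr w)).Nonempty
    · obtain ⟨d, hd⟩ := hH
      have h1 : P.worker d = w := incident_of_mem_head hd
      refine ⟨x d - y d, sub_nonneg.2 (le_of_mem_head hx hy hxy hη hclose (h1.symm ▸ hd)),
        fun e he => ?_⟩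
      linarith [(worker_side hx hy hxy hη hclose w).2.2 d hd e he]
    · exact ⟨0, le_rfl, fun e he => absurd ⟨e, he⟩ hH⟩
  choose φ hφ0 hφ using hφ
  choose ψ hψ0 hψ using hψ
  set p : (P.FPlus x → ℝ) × (P.WPlus x → ℝ) := (fun f => φ f.1, fun w => ψ w.1) with hp
  have hΔ : ∀ e, P.Delta x p e = y e - x e := by
    intro e
    by_cases hD : e ∈ P.potentialHead x (P.firm e)
    · rw [Delta_of_mem_potentialHead hx' p hD]
      by_cases hR : P.Regular x (Sum.inl (P.firm e))
      · rw [hφ _ e hD]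
        exact zeroExtend_val p.1 ⟨P.firm e, hR⟩
      · have h1 : y e = x e := eq_of_singular hx hy hxy hη hclose
          (by_contra fun h => hR ⟨fullyFilled_of_mem_potentialHead hD, h⟩) (P.atFirm e)
        rw [zeroExtend_of_not p.1 hR, h1, sub_self]
    · by_cases hH : e ∈ P.head x (Sum.inr (P.worker e))
      · rw [Delta_of_mem_head hx' p hH]
        by_cases hR : P.Regular x (Sum.inr (P.worker e))
        · rw [hψ _ e hH]
          exact congrArg _ (zeroExtend_val p.2 ⟨P.worker e, hR⟩)
        · have h1 : y e = x e := eq_of_singular hx hy hxy hη hclose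
            (by_contra fun h => hR ⟨fullyFilled_of_mem_head hH, h⟩) (P.atWorker e)
          rw [zeroExtend_of_not p.2 hR, h1, sub_self, neg_zero]
      · rw [Delta_of_notMem hx' p hD hH]
        have h1 : y e ≤ x e := not_lt.1 fun h =>
          hD (mem_potentialHead_of_lt hx hy hxy hη hclose h)
        have h2 : x e ≤ y e := not_lt.1 fun h =>
          hH ((worker_side hx hy hxy hη hclose (P.worker e)).2.1 (P.atWorker e) h)
        linarith
  have hbal : ∀ v, ∑ e with Incident v e.1, (y e - x e) = 0 := fun v => by
    rw [Finset.sum_sub_distrib, ← sum_star v y, ← sum_star v x]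
    exact sub_eq_zero.2 (sum_restr_eq hx' hy hxy v).symm
  refine ⟨p, (mem_balancePolytope_iff hx' p ε).2 ⟨fun f => ?_, fun w => ?_, ?_, fun f => hφ0 _,
    fun w => hψ0 _⟩, ?_⟩
  · simp only [hΔ]
    exact hbal (Sum.inl f.1)
  · simp only [hΔ]
    exact hbal (Sum.inr w.1)
  · simpa only [hΔ] using hsum
  · funext e
    rw [Pi.add_apply, hΔ]
    ring

end Close

/-! ### Balanced shifts are stable -/

section Shift

variable (hx : x ∈ P.stable) (hη : P.IsGap x η) (hε : ε < η) (hp : p ∈ P.balancePolytope x ε)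

include hx hp in
theorem abs_Delta_le (e : P.Edge) : |P.Delta x p e| ≤ ε :=
  (Finset.single_le_sum (f := fun e => |P.Delta x p e|) (fun _ _ => abs_nonneg _)
    (Finset.mem_univ e)).trans_eq
      ((mem_balancePolytope_iff (admissible_of_mem_stable hx) p ε).1 hp).2.2.1

include hx hp in
theorem Delta_nonneg_of_notMem_head (he : e ∉ P.head x (Sum.inr (P.worker e))) :
    0 ≤ P.Delta x p e := by
  rw [Delta_eq (admissible_of_mem_stable hx), if_neg he, sub_zero]
  split_ifs
  exacts [zeroExtend_nonneg hp.2.2.2.1 _, le_rfl]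

include hx hp in
theorem Delta_nonpos_of_notMem_potentialHead (he : e ∉ P.potentialHead x (P.firm e)) :
    P.Delta x p e ≤ 0 := by
  rw [Delta_eq (admissible_of_mem_stable hx), if_neg he, zero_sub, neg_nonpos]
  split_ifs
  exacts [zeroExtend_nonneg hp.2.2.2.2 _, le_rfl]

include hx hη hε hp

theorem admissible_add_Delta : P.Admissible (x + P.Delta x p) := by
  have hx' := admissible_of_mem_stable hx
  have habs := abs_Delta_le hx hp
  refine ⟨fun e => ?_, fun e => ?_, fun v => ?_⟩
  · rw [Pi.add_apply]
    by_cases hH : e ∈ P.head x (Sum.inr (P.worker e))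
    · linarith [hη.le e (hx'.pos_of_mem_head hH), (abs_le.1 (habs e)).1, hη.pos]
    · exact add_nonneg (hx'.nonneg e) (Delta_nonneg_of_notMem_head hx hp hH)
  · rw [Pi.add_apply]
    by_cases hD : e ∈ P.potentialHead x (P.firm e)
    · linarith [hη.le_cap e (raisable_of_mem_potentialHead hD).1, (abs_le.1 (habs e)).2, hη.pos]
    · linarith [hx'.le e, Delta_nonpos_of_notMem_potentialHead hx hp hD]
  · have h1 := sum_restr_Delta hx' hp v
    have h2 : ∑ e, P.restr (x + P.Delta x p) v e =
        ∑ e, P.restr x v e + ∑ e, P.restr (P.Delta x p) v e := Finset.sum_add_distrib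
    rw [h2, h1, add_zero]
    exact hx'.sum_le v

omit hη hε in
theorem sum_restr_add_Delta (v : F ⊕ W) :
    ∑ e, P.restr (x + P.Delta x p) v e = ∑ e, P.restr x v e := by
  have h2 : ∑ e, P.restr (x + P.Delta x p) v e =
      ∑ e, P.restr x v e + ∑ e, P.restr (P.Delta x p) v e := Finset.sum_add_distrib
  rw [h2, sum_restr_Delta (admissible_of_mem_stable hx) hp v, add_zero]

omit hη hε in
theorem dominates_add_Delta (f : F) : P.Dominates (Sum.inl f) x (x + P.Delta x p) := by
  rintro ⟨e, rfl⟩ he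
  have h1 : e ∉ P.potentialHead x (P.firm e) := fun h =>
    (raisable_of_mem_potentialHead h).notMem_tail hx he
  have h2 := Delta_nonpos_of_notMem_potentialHead hx hp h1
  rw [Pi.add_apply]
  linarith

/-- At `w` the shift lowers `H_w` uniformly and otherwise moves only edges of potential heads, which
lie in the tail of `w`; so `head_tail_eq_of_close` applies. -/
theorem tail_worker_add_Delta (w : W) :
    P.tail (x + P.Delta x p) (Sum.inr w) = P.tail x (Sum.inr w) := by
  have hx' := admissible_of_mem_stable hx
  have hs := sum_restr_add_Delta hx hp (Sum.inr w)
  by_cases hw : P.FullyFilled x (Sum.inr w)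
  · have hhead : ∀ a ∈ MixedChoice.head (P.ge (Sum.inr w)) (P.q (Sum.inr w))
        (P.restr x (Sum.inr w)), P.restr (x + P.Delta x p) (Sum.inr w) a =
          MixedChoice.cutHeight (P.ge (Sum.inr w)) (P.q (Sum.inr w))
            (P.restr x (Sum.inr w)) + - zeroExtend p.2 w := by
      intro a ha
      have h1 : P.worker a.1 = w := a.2
      have h2 := Delta_of_mem_head hx' p (e := a.1) (h1.symm ▸ (mem_head_val a).2 ha)
      rw [h1] at h2
      rw [← MixedChoice.eq_cutHeight_of_mem_head ha, ← h2]
      rfl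
    have h := (MixedChoice.head_tail_eq_of_close (P.isWeakOrder (Sum.inr w)) (P.q_pos _)
      (hx'.restr_nonneg _) ((admissible_add_Delta hx hη hε hp).restr_nonneg _) hw (hs.trans hw)
      (η := η) (fun e => ?_) (fun e => hη.le e.1) (fun d e => hη.le_sub d.1 e.1)
      (fun d hd e he => (hhead d hd).trans (hhead e he).symm) ?_).2
    · rw [tail, tail, h]
    · have h1 : P.restr (x + P.Delta x p) (Sum.inr w) e - P.restr x (Sum.inr w) e =
          P.Delta x p e.1 := by simp [restr]
      rw [h1]
      exact (abs_Delta_le hx hp e.1).trans_lt hε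
    · rintro ⟨e, rfl⟩ he h0
      change x e = 0 at h0
      have hD : e ∉ P.potentialHead x (P.firm e) := fun h =>
        he ((mem_tail_val (P.atWorker e)).1 (raisable_of_mem_potentialHead h).2)
      have hH : e ∉ P.head x (Sum.inr (P.worker e)) := fun h =>
        (hx'.pos_of_mem_head h).ne' h0
      change x e + P.Delta x p e = 0
      rw [Delta_of_notMem hx' p hD hH, h0, add_zero]
  · rw [tail, tail, MixedChoice.tail_of_ne hw, MixedChoice.tail_of_ne fun h => hw (hs.symm.trans h)]

/-- The tails at the firms after a balanced shift. -/
theorem tail_firm_add_Delta (he : e ∈ P.tail (x + P.Delta x p) (Sum.inl (P.firm e))) :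
    e ∉ P.potentialHead x (P.firm e) ∧ (e ∈ P.tail x (Sum.inl (P.firm e)) ∧ P.Delta x p e = 0 ∨
      ∃ d : P.Star (Sum.inl (P.firm e)), d.1 ∈ P.potentialHead x (P.firm e) ∧
        P.ge (Sum.inl (P.firm e)) (P.atFirm e) d) := by
  have hx' := admissible_of_mem_stable hx
  set f := P.firm e with hf
  by_cases hφ : 0 < zeroExtend p.1 f
  · have hR : P.Regular x (Sum.inl f) := by
      by_contra hR
      rw [zeroExtend_of_not p.1 hR] at hφ
      exact hφ.false
    obtain ⟨d, hd⟩ := hR.potentialHead_nonempty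
    have hdf := firm_eq_of_mem_potentialHead hd
    have h := MixedChoice.mem_tail_of_raise (P.isWeakOrder (Sum.inl f)) (P.q_pos _)
      (hx'.restr_nonneg _) ((admissible_add_Delta hx hη hε hp).restr_nonneg _)
      ((sum_restr_add_Delta hx hp (Sum.inl f)).trans hR.1)
      (D := {a : P.Star (Sum.inl f) | a.1 ∈ P.potentialHead x f}) hφ (fun a ha => ?_)
      (fun a ha => ?_) (fun a ha h => ?_) (fun a ha a' ha' => ?_) (d := ⟨d, hdf⟩) (e := P.atFirm e)
      hd
    · obtain ⟨h1, h2⟩ := h.1 ((mem_tail_val (P.atFirm e)).1 he)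
      exact ⟨h2, Or.inr ⟨⟨d, hdf⟩, hd, h1⟩⟩
    · have h1 : P.firm a.1 = f := a.2
      have h2 := Delta_of_mem_potentialHead hx' p (e := a.1) (h1.symm ▸ ha)
      rw [h1] at h2
      rw [← h2]
      rfl
    · have h1 : P.firm a.1 = f := a.2
      have h2 := Delta_nonpos_of_notMem_potentialHead hx hp (e := a.1) (h1.symm ▸ ha)
      change x a.1 + P.Delta x p a.1 ≤ x a.1
      linarith
    · have h1 := (raisable_of_mem_potentialHead ha).notMem_tail hx
      rw [show P.firm a.1 = f from a.2] at h1
      exact h1 ((mem_tail_val a).2 h)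
    · exact ge_of_mem_potentialHead ha (raisable_of_mem_potentialHead ha')
  -- With `φ_f = 0` no edge at `f` increases, and the net change is zero, so nothing at `f` moves.
  · have h0 : zeroExtend p.1 f = 0 :=
      le_antisymm (not_lt.1 hφ) (zeroExtend_nonneg hp.2.2.2.1 f)
    have hle : ∀ a ∈ Finset.univ, P.restr (P.Delta x p) (Sum.inl f) a ≤ 0 := fun a _ => by
      have h1 : P.firm a.1 = f := a.2
      by_cases hD : a.1 ∈ P.potentialHead x (P.firm a.1)
      · exact (Delta_of_mem_potentialHead hx' p hD).trans_le (by rw [h1, h0])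
      · exact Delta_nonpos_of_notMem_potentialHead hx hp hD
    have hzero := (Finset.sum_eq_zero_iff_of_nonpos hle).1 (sum_restr_Delta hx' hp (Sum.inl f))
    have htail : P.tail (x + P.Delta x p) (Sum.inl f) = P.tail x (Sum.inl f) :=
      tail_congr fun a => by
        have h1 : P.Delta x p a.1 = 0 := hzero a (Finset.mem_univ a)
        rw [Pi.add_apply, h1, add_zero]
    rw [htail] at he
    exact ⟨fun h => (raisable_of_mem_potentialHead h).notMem_tail hx he,
      Or.inl ⟨he, hzero (P.atFirm e) (Finset.mem_univ _)⟩⟩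

/-- A blocking edge is in the unchanged worker's tail, so it did not decrease and was raisable,
hence outside the firm's old tail. In the new tail it is at least as good as `D_f`, so belongs to
`D_f`, which that tail avoids. -/
theorem add_Delta_mem_stable : x + P.Delta x p ∈ P.stable := by
  have hx' := admissible_of_mem_stable hx
  refine (P.mem_stable_iff _).2 ⟨admissible_add_Delta hx hη hε hp, fun e hu hf hw => ?_⟩
  rw [tail_worker_add_Delta hx hη hε hp] at hw
  rw [Pi.add_apply] at hu
  have hr : P.Raisable x e := by
    refine ⟨?_, hw⟩
    have := Delta_nonneg_of_notMem_head hx hp fun h => hx'.notMem_tail_of_mem_head h hw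
    linarith
  obtain ⟨h1, ⟨h2, -⟩ | ⟨d, hd, hge⟩⟩ := tail_firm_add_Delta hx hη hε hp hf
  · exact hr.notMem_tail hx h2
  · exact h1 (mem_potentialHead_of_ge hd hr hge)

theorem add_Delta_mem_close (hε0 : 0 < ε) : x + P.Delta x p ∈ P.close x ε := by
  have hx' := admissible_of_mem_stable hx
  have hsum : ∑ e, |(x + P.Delta x p) e - x e| = ε := by
    simpa using ((mem_balancePolytope_iff hx' p ε).1 hp).2.2.1
  refine ⟨add_Delta_mem_stable hx hη hε hp,
    ⟨(hx'.prefersF_iff _).2 (dominates_add_Delta hx hp), fun h => ?_⟩, hsum⟩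
  rw [← h] at hsum
  simp only [sub_self, abs_zero, Finset.sum_const_zero] at hsum
  exact hε0.ne hsum

end Shift

theorem close_eq (hx : x ∈ P.stable) (hη : P.IsGap x η) (hε0 : 0 < ε) (hε : ε < η) :
    P.close x ε = {x' | ∃ p ∈ P.balancePolytope x ε, x' = x + P.Delta x p} := by
  ext x'
  constructor
  · rintro ⟨hst, ⟨hpref, -⟩, hsum⟩
    refine exists_eq_add_Delta hx hst (((admissible_of_mem_stable hx).prefersF_iff x').1 hpref)
      hη (fun e => ?_) hsum
    refine lt_of_le_of_lt ?_ hε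
    exact (Finset.single_le_sum (f := fun e => |x' e - x e|) (fun e _ => abs_nonneg _)
      (Finset.mem_univ e)).trans_eq hsum
  · rintro ⟨p, hp, rfl⟩
    exact add_Delta_mem_close hx hη hε hp hε0

end MixedProblem
end

/-! ### Part (b): circulations on the moved vertices -/

noncomputable section

/-- A finite stochastic matrix has a stationary vector. -/
theorem exists_stationary_of_stochastic {V : Type*} [Fintype V] [Nonempty V] (M : V → V → ℝ)
    (hM : ∀ i j, 0 ≤ M i j) (hrow : ∀ i, ∑ j, M i j = 1) :
    ∃ m : V → ℝ, (∀ i, 0 ≤ m i) ∧ m ≠ 0 ∧ ∀ j, ∑ i, m i * M i j = m j := by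
  classical
  -- The all-ones vector is in the right kernel of `M - 1`, so there is also a nonzero left kernel
  -- vector `u`, of unknown signs.
  have hdet : (Matrix.of M - 1).det = 0 := by
    refine Matrix.exists_mulVec_eq_zero_iff.1 ⟨fun _ => 1, ?_, ?_⟩
    · exact fun h => one_ne_zero (congrFun h (Classical.arbitrary V))
    · funext i
      simp [Matrix.mulVec, dotProduct, hrow, Matrix.one_apply]
  obtain ⟨u, hu, hu0⟩ := Matrix.exists_vecMul_eq_zero_iff.2 hdet
  have hfix : ∀ j, ∑ i, u i * M i j = u j := fun j => by
    have := congrFun hu0 j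
    rw [Matrix.vecMul_sub, Matrix.vecMul_one, Pi.sub_apply, Pi.zero_apply, sub_eq_zero] at this
    exact this
  refine ⟨fun i => |u i|, fun i => abs_nonneg _, fun h => hu ?_, fun j => ?_⟩
  · funext i
    exact abs_eq_zero.1 (congrFun h i)
  -- Taking absolute values gives `|u| ≤ |u| M`; row sums 1 make the totals equal, so `|u|` is
  -- stationary too.
  · have hle : ∀ j ∈ Finset.univ, |u j| ≤ ∑ i, |u i| * M i j := fun j _ => by
      calc |u j| = |∑ i, u i * M i j| := by rw [hfix]
        _ ≤ ∑ i, |u i * M i j| := Finset.abs_sum_le_sum_abs _ _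
        _ = ∑ i, |u i| * M i j :=
          Finset.sum_congr rfl fun i _ => by rw [abs_mul, abs_of_nonneg (hM i j)]
    refine ((Finset.sum_eq_sum_iff_of_le hle).1 ?_ j (Finset.mem_univ j)).symm
    rw [Finset.sum_comm]
    exact Finset.sum_congr rfl fun i _ => by rw [← Finset.mul_sum, hrow, mul_one]

namespace MixedProblem

open scoped Classical

variable {F W : Type*} [Fintype F] [Fintype W] {P : MixedProblem F W} {x y : P.Edge → ℝ}
  {v : F ⊕ W} {f : F} {w : W} {e : P.Edge} {p : (P.FPlus x → ℝ) × (P.WPlus x → ℝ)} {ε : ℝ}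

omit [Fintype F] [Fintype W] in
theorem Delta_smul (hx : P.Admissible x) (t : ℝ) (p : (P.FPlus x → ℝ) × (P.WPlus x → ℝ)) :
    P.Delta x (t • p) = t • P.Delta x p := by
  funext e
  have h1 : zeroExtend (t • p).1 (P.firm e) = t * zeroExtend p.1 (P.firm e) := by
    unfold zeroExtend
    split_ifs <;> simp
  have h2 : zeroExtend (t • p).2 (P.worker e) = t * zeroExtend p.2 (P.worker e) := by
    unfold zeroExtend
    split_ifs <;> simp
  rw [Pi.smul_apply, smul_eq_mul, Delta_eq hx, Delta_eq hx, h1, h2]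
  split_ifs <;> ring

theorem smul_mem_balancePolytope (hx : P.Admissible x) (hp : p ∈ P.balancePolytope x ε) {t : ℝ}
    (ht : 0 ≤ t) : t • p ∈ P.balancePolytope x (t * ε) := by
  obtain ⟨h1, h2, h3, h4, h5⟩ := (mem_balancePolytope_iff hx p ε).1 hp
  refine (mem_balancePolytope_iff hx _ _).2 ⟨fun f => ?_, fun w => ?_, ?_,
    fun f => mul_nonneg ht (h4 f), fun w => mul_nonneg ht (h5 w)⟩
  · simp only [Delta_smul hx, Pi.smul_apply, smul_eq_mul, ← Finset.mul_sum, h1, mul_zero]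
  · simp only [Delta_smul hx, Pi.smul_apply, smul_eq_mul, ← Finset.mul_sum, h2, mul_zero]
  · simp only [Delta_smul hx, Pi.smul_apply, smul_eq_mul, abs_mul, abs_of_nonneg ht,
      ← Finset.mul_sum, h3]

/-! ### Vertices at which two assignments differ -/

variable (P) in
/-- `x` and `y` differ at `v`. -/
def Moved (x y : P.Edge → ℝ) (v : F ⊕ W) : Prop := ∃ e : P.Star v, y e.1 ≠ x e.1

section Moved

variable (hx : x ∈ P.stable) (hy : y ∈ P.stable) (hxy : ∀ f, P.Dominates (Sum.inl f) x y)

include hx hy hxy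

theorem Moved.fullyFilled (hv : P.Moved x y v) : P.FullyFilled x v := by
  obtain ⟨e, he⟩ := hv
  by_contra h
  exact he (eq_of_not_fullyFilled hx hy hxy h e)

theorem Moved.lt_of_mem_head (hw : P.Moved x y (Sum.inr w)) (he : e ∈ P.head x (Sum.inr w)) :
    y e < x e := by
  have hx' := admissible_of_mem_stable hx
  obtain ⟨a, ha⟩ := hw
  exact MixedChoice.lt_of_mem_head (z := P.restr y (Sum.inr w)) (z' := P.restr x (Sum.inr w))
    (P.isWeakOrder _) (P.q_pos _) ((admissible_of_mem_stable hy).restr_nonneg _)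
    (hx'.restr_nonneg _) (sum_restr_eq hx' hy hxy (Sum.inr w)).symm
    (dominates_worker hx' hy hxy w).agent (fun h => ha (congrFun h a))
    ((mem_head_val ⟨e, incident_of_mem_head he⟩).1 he)

theorem Moved.exists_lt (hf : P.Moved x y (Sum.inl f)) :
    ∃ a : P.Star (Sum.inl f), x a.1 < y a.1 := by
  obtain ⟨a, ha⟩ := hf
  by_contra! hcon
  have hle : ∀ a ∈ Finset.univ, P.restr y (Sum.inl f) a ≤ P.restr x (Sum.inl f) a :=
    fun a _ => hcon a
  exact ha ((Finset.sum_eq_sum_iff_of_le hle).1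
    (sum_restr_eq (admissible_of_mem_stable hx) hy hxy (Sum.inl f)).symm a (Finset.mem_univ a))

/-- No closeness is needed: if the worker of `d` did not move, `d` would be raisable under `y` with
the same value, hence outside the firm's tail, yet at least as good as an increasing edge, against
`not_ge_of_raisable`. -/
theorem Moved.worker_moved (hf : P.Moved x y (Sum.inl f)) {d : P.Star (Sum.inl f)}
    (hd : P.Raisable x d.1)
    (hbest : ∀ a : P.Star (Sum.inl f), P.Raisable x a.1 → P.ge (Sum.inl f) d a) :
    P.Moved x y (Sum.inr (P.worker d.1)) := by
  obtain ⟨a, ha⟩ := hf.exists_lt hx hy hxy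
  by_contra hcon
  have heq : ∀ e : P.Star (Sum.inr (P.worker d.1)), y e.1 = x e.1 := fun e => by
    by_contra h
    exact hcon ⟨e, h⟩
  have hde : y d.1 = x d.1 := heq (P.atWorker d.1)
  have hnt := notMem_tail_firm hy (e := d.1) (hde.trans_lt hd.1) (by
    rw [tail_congr heq]
    exact hd.2)
  rw [show P.firm d.1 = f from d.2] at hnt
  exact not_ge_of_raisable hx hy hxy ha hd hnt hde.le (hbest a (raisable_of_lt hx hy hxy ha))

/-- Some edge at `f` increases, so raisable edges exist. Those in the best tie have moved, hence
fully filled, workers, so that tie satisfies the condition on deficit workers. -/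
theorem Moved.potentialHead_nonempty (hf : P.Moved x y (Sum.inl f)) :
    (P.potentialHead x f).Nonempty := by
  obtain ⟨a, ha⟩ := hf.exists_lt hx hy hxy
  obtain ⟨d, hd, hbest⟩ := (P.isWeakOrder (Sum.inl f)).exists_best
    (s := Finset.univ.filter fun a : P.Star (Sum.inl f) => P.Raisable x a.1)
    ⟨a, by simpa using raisable_of_lt hx hy hxy ha⟩
  simp only [Finset.mem_filter, Finset.mem_univ, true_and] at hd hbest
  exact ⟨d.1, mem_potentialHead_of_best (hf.fullyFilled hx hy hxy) hd hbest fun a' ha' hge =>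
    (hf.worker_moved hx hy hxy ha' fun a'' ha'' =>
      P.ge_trans _ _ _ _ hge (hbest a'' ha'')).fullyFilled hx hy hxy⟩

theorem Moved.outHead_nonempty (hv : P.Moved x y v) : (P.outHead x v).Nonempty := by
  cases v with
  | inl f => exact hv.potentialHead_nonempty hx hy hxy
  | inr w => exact (admissible_of_mem_stable hx).head_nonempty (hv.fullyFilled hx hy hxy)

variable (P) in
/-- The end of `e` in the color class not containing `v`. -/
def opposite : F ⊕ W → P.Edge → F ⊕ W
  | Sum.inl _, e => Sum.inr (P.worker e)
  | Sum.inr _, e => Sum.inl (P.firm e)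

theorem Moved.opposite_moved (hv : P.Moved x y v) (he : e ∈ P.outHead x v) :
    P.Moved x y (P.opposite v e) := by
  cases v with
  | inl f =>
    exact hv.worker_moved hx hy hxy (d := ⟨e, firm_eq_of_mem_potentialHead he⟩)
      (raisable_of_mem_potentialHead he) fun a ha => ge_of_mem_potentialHead he ha
  | inr w => exact ⟨P.atFirm e, (hv.lt_of_mem_head hx hy hxy he).ne⟩

/-- Moved vertices are fully filled, have nonempty heads and are closed under following head edges,
so the cleaning procedure never reaches one. -/
theorem Moved.regular (hv : P.Moved x y v) : P.Regular x v := by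
  refine ⟨hv.fullyFilled hx hy hxy, fun hs => ?_⟩
  induction hs with
  | ofWorker w e hw he hd => exact hd ((hv.opposite_moved hx hy hxy he).fullyFilled hx hy hxy)
  | ofFirm f hf hD => exact (hv.potentialHead_nonempty hx hy hxy).ne_empty hD
  | step v u e hv' he hu hs ih =>
    have hopp := hv.opposite_moved hx hy hxy he
    -- The incident vertex `u` may be `v` itself or the opposite end; both are moved.
    cases v with
    | inl f =>
      have h1 : P.firm e = f := firm_eq_of_mem_potentialHead he
      cases u with
      | inl f' =>
        have h2 : P.firm e = f' := hu
        exact ih (by rwa [← h2, h1])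
      | inr w' => exact ih (by rwa [← show e.1.2 = w' from hu])
    | inr w =>
      have h1 : P.worker e = w := incident_of_mem_head he
      cases u with
      | inl f' => exact ih (by rwa [← show e.1.1 = f' from hu])
      | inr w' =>
        have h2 : P.worker e = w' := hu
        exact ih (by rwa [← h2, h1])

/-- A circulation supported on the vertices at which `x` and `y` differ. -/
theorem exists_circulation (hne : x ≠ y) : ∃ c : F ⊕ W → ℝ, (∀ v, 0 ≤ c v) ∧
    (∀ v, ¬ P.Moved x y v → c v = 0) ∧ (∃ v, P.Moved x y v ∧ c v ≠ 0) ∧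
    ∀ v, ((P.outHead x v).card : ℝ) * c v =
      ∑ u, ((P.outHead x u).filter fun e => P.opposite u e = v).card * c u := by
  have hcard : ∀ u : {v // P.Moved x y v}, (0 : ℝ) < (P.outHead x u.1).card := fun u =>
    Nat.cast_pos.2 (u.2.outHead_nonempty hx hy hxy).card_pos
  obtain ⟨e, he⟩ := Function.ne_iff.1 hne
  have : Nonempty {v // P.Moved x y v} := ⟨⟨Sum.inl (P.firm e), P.atFirm e, he.symm⟩⟩
  -- Random walk: from `u`, follow a uniformly chosen head edge. Rows sum to 1 because head edges do
  -- not leave the moved set.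
  obtain ⟨m, hm0, hm, hfix⟩ := exists_stationary_of_stochastic
    (fun u v : {v // P.Moved x y v} =>
      (((P.outHead x u.1).filter fun e => P.opposite u.1 e = v.1).card : ℝ) /
        (P.outHead x u.1).card) (fun u v => by positivity) fun u => by
      rw [← Finset.sum_div, div_eq_one_iff_eq (hcard u).ne', ← Nat.cast_sum]
      congr 1
      rw [Finset.card_eq_sum_card_fiberwise (f := P.opposite u.1)
        (t := Finset.univ.filter fun v => P.Moved x y v) fun e he =>
          Finset.mem_coe.2 (Finset.mem_filter.2 ⟨Finset.mem_univ _,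
            u.2.opposite_moved hx hy hxy (Finset.mem_coe.1 he)⟩)]
      exact (Finset.sum_subtype (p := P.Moved x y) _ (fun v => by simp) fun v =>
        ((P.outHead x u.1).filter fun e => P.opposite u.1 e = v).card).symm
  -- Dividing the stationary mass by the head size gives the flow per head edge, the role played by
  -- `φ` and `ψ`.
  set g : {v // P.Moved x y v} → ℝ := fun v => m v / (P.outHead x v.1).card with hg
  refine ⟨zeroExtend g, zeroExtend_nonneg fun v => div_nonneg (hm0 v) (hcard v).le,
    fun v hv => zeroExtend_of_not g hv, ?_, fun v => ?_⟩
  · obtain ⟨v, hv⟩ := Function.ne_iff.1 hm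
    refine ⟨v.1, v.2, ?_⟩
    rw [zeroExtend_val]
    exact div_ne_zero hv (hcard v).ne'
  · have h1 := sum_zeroExtend g (fun _ => True) fun u =>
      (((P.outHead x u).filter fun e => P.opposite u e = v).card : ℝ)
    simp only [Finset.filter_true] at h1
    rw [← h1]
    by_cases hv : P.Moved x y v
    · have h2 := hfix ⟨v, hv⟩
      have h3 : ((P.outHead x v).card : ℝ) * zeroExtend g v = m ⟨v, hv⟩ := by
        rw [show zeroExtend g v = g ⟨v, hv⟩ from zeroExtend_val g ⟨v, hv⟩]
        exact mul_div_cancel₀ _ (hcard ⟨v, hv⟩).ne'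
      rw [h3, ← h2]
      refine Finset.sum_congr rfl fun u _ => ?_
      simp only [hg]
      ring
    · rw [zeroExtend_of_not g hv, mul_zero]
      refine (Finset.sum_eq_zero fun u _ => ?_).symm
      rw [Finset.filter_false_of_mem, Finset.card_empty, Nat.cast_zero, zero_mul]
      rintro e he rfl
      exact hv (u.2.opposite_moved hx hy hxy he)

/-- The balance system has a solution supported on the vertices at which `x` and `y` differ. -/
theorem exists_mem_balancePolytope (hne : x ≠ y) : ∃ p ∈ P.balancePolytope x 1,
    ∀ w, ¬ P.Moved x y (Sum.inr w) → zeroExtend p.2 w = 0 := by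
  have hx' := admissible_of_mem_stable hx
  obtain ⟨c, hc0, hsupp, ⟨v, hv, hcv⟩, hbal⟩ := exists_circulation hx hy hxy hne
  set p : (P.FPlus x → ℝ) × (P.WPlus x → ℝ) :=
    (fun f => c (Sum.inl f.1), fun w => c (Sum.inr w.1)) with hp
  have hF : ∀ f, zeroExtend p.1 f = c (Sum.inl f) := fun f => by
    by_cases hR : P.Regular x (Sum.inl f)
    · exact zeroExtend_val p.1 ⟨f, hR⟩
    · rw [zeroExtend_of_not p.1 hR, hsupp _ fun h => hR (h.regular hx hy hxy)]
  have hW : ∀ w, zeroExtend p.2 w = c (Sum.inr w) := fun w => by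
    by_cases hR : P.Regular x (Sum.inr w)
    · exact zeroExtend_val p.2 ⟨w, hR⟩
    · rw [zeroExtend_of_not p.2 hR, hsupp _ fun h => hR (h.regular hx hy hxy)]
  have hpS : p ∈ P.balancePolytope x (∑ e, |P.Delta x p e|) := by
    refine (mem_balancePolytope_iff hx' p _).2 ⟨fun f => ?_, fun w => ?_, rfl, fun f => hc0 _,
      fun w => hc0 _⟩
    · simp only [Delta_eq hx', hF, hW]
      rw [Finset.sum_sub_distrib, sum_firm_potentialHead x f.1 fun f => c (Sum.inl f), sub_eq_zero]
      refine (hbal (Sum.inl f.1)).trans ?_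
      rw [Fintype.sum_sum_type]
      simp only [opposite, reduceCtorEq, Finset.filter_false, Finset.card_empty, Nat.cast_zero,
        zero_mul, Finset.sum_const_zero, zero_add, Sum.inl.injEq, outHead]
      rw [Finset.sum_filter, ← sum_sum_worker]
      refine Finset.sum_congr rfl fun w _ => ?_
      rw [← nsmul_eq_mul, ← Finset.sum_const, ← Finset.sum_filter, ← Finset.sum_filter,
        Finset.filter_filter, Finset.filter_filter]
      refine Finset.sum_congr ?_ ?_
      · ext e
        simp only [Finset.mem_filter, Finset.mem_univ, true_and]
        constructor
        · rintro ⟨h1, h2⟩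
          have h3 : P.worker e = w := incident_of_mem_head h1
          exact ⟨h3, h2, h3.symm ▸ h1⟩
        · rintro ⟨h1, h2, h3⟩
          exact ⟨h1 ▸ h3, h2⟩
      · intro e he
        rw [(Finset.mem_filter.1 he).2.1]
    · simp only [Delta_eq hx', hF, hW]
      rw [Finset.sum_sub_distrib, sum_worker_head x w.1 fun w => c (Sum.inr w), sub_eq_zero]
      refine Eq.trans ?_ (hbal (Sum.inr w.1)).symm
      rw [Fintype.sum_sum_type]
      simp only [opposite, reduceCtorEq, Finset.filter_false, Finset.card_empty, Nat.cast_zero,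
        zero_mul, Finset.sum_const_zero, add_zero, Sum.inr.injEq, outHead]
      rw [Finset.sum_filter, ← sum_sum_firm]
      refine Finset.sum_congr rfl fun f _ => ?_
      rw [← nsmul_eq_mul, ← Finset.sum_const, ← Finset.sum_filter, ← Finset.sum_filter,
        Finset.filter_filter, Finset.filter_filter]
      refine Finset.sum_congr ?_ ?_
      · ext e
        simp only [Finset.mem_filter, Finset.mem_univ, true_and]
        constructor
        · rintro ⟨h1, h2, h3⟩
          exact ⟨h1 ▸ h3, h2⟩
        · rintro ⟨h1, h2⟩
          have h3 : P.firm e = f := firm_eq_of_mem_potentialHead h1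
          exact ⟨h3, h2, h3.symm ▸ h1⟩
      · intro e he
        rw [firm_eq_of_mem_potentialHead (Finset.mem_filter.1 he).1]
  have hS : 0 < ∑ e, |P.Delta x p e| := by
    obtain ⟨e, he⟩ := hv.outHead_nonempty hx hy hxy
    refine Finset.sum_pos' (fun e _ => abs_nonneg _) ⟨e, Finset.mem_univ e, abs_pos.2 ?_⟩
    cases v with
    | inl f =>
      have h1 : P.firm e = f := firm_eq_of_mem_potentialHead he
      rw [Delta_of_mem_potentialHead hx' p (h1.symm ▸ he), hF, h1]
      exact hcv
    | inr w =>
      have h1 : P.worker e = w := incident_of_mem_head he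
      rw [Delta_of_mem_head hx' p (h1.symm ▸ he), hW, h1]
      exact neg_ne_zero.2 hcv
  refine ⟨(∑ e, |P.Delta x p e|)⁻¹ • p, ?_, fun w hw => ?_⟩
  · have h1 := smul_mem_balancePolytope hx' hpS (inv_nonneg.2 hS.le)
    rwa [inv_mul_cancel₀ hS.ne'] at h1
  · have h1 := hW w
    rw [hsupp _ hw] at h1
    unfold zeroExtend at h1 ⊢
    split_ifs with hR
    · rw [dif_pos hR] at h1
      change _ * p.2 ⟨w, hR⟩ = 0
      rw [h1, mul_zero]
    · rfl

/-- Suppose `y` exceeds the shift on an edge `e` of the firm's new tail. As `ε` is below every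
positive drop `x e - y e`, `x e ≤ y e`; and `x e < y e` would make `e` raisable, which that tail
excludes. So `y e = x e` and the shift lowers `e`. Then `e` is in the head of a moved worker, where
`y e < x e`. -/
theorem exists_close_between (hne : x ≠ y) : ∃ ε₀ : ℝ, 0 < ε₀ ∧ ∀ ε : ℝ, 0 < ε → ε < ε₀ →
    ∃ x' ∈ P.close x ε, P.PrefersF x' y ∧ P.StrictlyPrefersF x x' := by
  have hx' := admissible_of_mem_stable hx
  obtain ⟨p, hp, hsupp⟩ := exists_mem_balancePolytope hx hy hxy hne
  obtain ⟨η, hη⟩ := P.exists_isGap x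
  obtain ⟨γ, hγ0, hγ⟩ := exists_pos_forall_le fun e => x e - y e
  refine ⟨min η γ, lt_min hη.pos hγ0, fun ε hε0 hε => ?_⟩
  have hεη := hε.trans_le (min_le_left _ _)
  have hεγ := hε.trans_le (min_le_right _ _)
  have hpε := smul_mem_balancePolytope hx' hp hε0.le
  rw [mul_one] at hpε
  have hclose := add_Delta_mem_close hx hη hεη hpε hε0
  refine ⟨_, hclose, ((admissible_add_Delta hx hη hεη hpε).prefersF_iff y).2 ?_, hclose.2.1⟩
  rintro f ⟨e, rfl⟩ he
  by_contra! hlt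
  rw [Pi.add_apply] at hlt
  obtain ⟨hD, htail⟩ := tail_firm_add_Delta hx hη hεη hpε he
  have hxle : x e ≤ y e := by
    by_contra! h
    have h1 := hγ e (sub_pos.2 h)
    have h2 := (abs_le.1 (abs_Delta_le hx hpε e)).1
    linarith
  have hyle : y e ≤ x e := by
    by_contra! h
    rcases htail with ⟨h1, -⟩ | ⟨d, hd, hge⟩
    · exact (hxy (P.firm e) (P.atFirm e) h1).not_gt h
    · exact hD (mem_potentialHead_of_ge hd (raisable_of_lt hx hy hxy h) hge)
  have hneg : P.Delta x (ε • p) e < 0 := by linarith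
  have hH : e ∈ P.head x (Sum.inr (P.worker e)) := by
    by_contra h
    exact (Delta_nonneg_of_notMem_head hx hpε h).not_gt hneg
  have hw : P.Moved x y (Sum.inr (P.worker e)) := by
    by_contra h
    rw [Delta_smul hx', Pi.smul_apply, Delta_of_mem_head hx' p hH, hsupp _ h] at hneg
    simp at hneg
  exact (hw.lt_of_mem_head hx hy hxy hH).not_ge hxle

end Moved

end MixedProblem
end

theorem mainTheorem1 {F W : Type*} [Fintype F] [Fintype W] (P : MixedProblem F W)
    (x : P.Edge → ℝ) (hx : x ∈ P.stable) (hxmax : ¬ P.IsXmax x) :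
    (∃ ε₀ : ℝ, 0 < ε₀ ∧ ∀ ε : ℝ, 0 < ε → ε < ε₀ →
      Bornology.IsBounded (P.balancePolytope x ε) ∧
      P.close x ε = {x' | ∃ p ∈ P.balancePolytope x ε, x' = x + P.Delta x p}) ∧
    (∀ y ∈ P.stable, P.StrictlyPrefersF x y →
      ∃ ε₀ : ℝ, 0 < ε₀ ∧ ∀ ε : ℝ, 0 < ε → ε < ε₀ →
        ∃ x' ∈ P.close x ε, P.PrefersF x' y ∧ P.StrictlyPrefersF x x') := by
  have hx' := MixedProblem.admissible_of_mem_stable hx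
  obtain ⟨η, hη⟩ := P.exists_isGap x
  exact ⟨⟨η, hη.pos, fun ε hε0 hε => ⟨MixedProblem.isBounded_balancePolytope hx' ε,
    MixedProblem.close_eq hx hη hε0 hε⟩⟩, fun y hy hxy =>
      MixedProblem.exists_close_between hx hy ((hx'.prefersF_iff y).1 hxy.1) hxy.2⟩
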